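/- **Theorem 2.2.** Let $B:\mathbb{R}^2\to\mathbb{R}$ satisfy $B\in L^p_{\rm loc}(\mathbb{R}^2)$ for some $p>2$ and $|B(x)|=\mathcal{O}(|x|^{-\tau})$ as $|x|\to\infty$ for some $\tau>2$. Let $$\alpha=\frac1{2\pi}\int_{\mathbb{R}^2}B\,dx,\qquad \mu_\alpha=\min_{m\in\mathbb{Z}}|m-\alpha|,\qquad h(x)=-\frac1{2\pi}\int_{\mathbb{R}^2}B(y)\log|x-y|\,dy ,$$ and suppose that $0<\alpha\notin\mathbb{Z}$. For $\rho>0$ let $g_+(\rho;r)=1$ if $r\le\rho$ and $g_+(\rho;r)=\rho^{-\alpha}r^{\alpha}$ if $r>\rho$, and put $$k_+(\rho)=\inf_{x\in\mathbb{R}^2}\frac{e^{-h(x)}}{g_+(\rho;|x|)},\qquad K_+(\rho)=\sup_{x\in\mathbb{R}^2}\frac{e^{-h(x)}}{g_+(\rho;|x|)},\qquad \beta_+(B;\rho)=\Big(\frac{k_+(\rho)}{K_+(\rho)}\Big)^2 .$$ Let $A\in L^\infty(\mathbb{R}^2;\mathbb{R}^2)$ be such that $\nabla\times A=\partial_1A_2-\partial_2A_1=B$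 in the sense of distributions, and for $u\in H^1(\mathbb{R}^2)$ (complex valued) let $$Q_+[u]=\int_{\mathbb{R}^2}\big(|(i\nabla+A)u|^2+B|u|^2\big)\,dx .$$ Then the integral defining $h(x)$ converges absolutely for every $x\in\mathbb{R}^2$, and, for all $\rho>0$, $0<k_+(\rho)\le K_+(\rho)<\infty$. Moreover, for all $\rho>0$ and all $u\in H^1(\mathbb{R}^2)$, the integrals in the following inequality converge absolutely and $$Q_+[u]\;\ge\;\mu_\alpha^2\,\beta_+(B;\rho)\int_{\mathbb{R}^2}\frac{|u(x)|^2}{\rho^2+|x|^2}\,dx .$$ -/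

import Mathlib

open MeasureTheory
open scoped ENNReal ContDiff

namespace PauliHardy

/-- The Euclidean plane `ℝ²`, with the Euclidean norm and Lebesgue measure `volume`. -/
abbrev Plane : Type := EuclideanSpace ℝ (Fin 2)

/-- The (classical) partial derivative of a real function on the plane. -/
noncomputable def partialDeriv (i : Fin 2) (φ : Plane → ℝ) (x : Plane) : ℝ :=
  fderiv ℝ φ x (EuclideanSpace.single i (1 : ℝ))

/-- Real valued test functions, the elements of `C₀^∞(ℝ²)`. Testing against these is the same as
testing against complex valued test functions, by linearity. -/
def IsTestFunction (φ : Plane → ℝ) : Prop :=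
  ContDiff ℝ ∞ φ ∧ HasCompactSupport φ

/-- `u ∈ H¹(ℝ²)` (complex valued), with weak partial derivatives `Du 0 = ∂₁u` and `Du 1 = ∂₂u`:
the function `u` and its distributional partial derivatives are square integrable. The family `Du`
is determined by `u` up to equality almost everywhere. -/
structure HasH1Gradient (u : Plane → ℂ) (Du : Fin 2 → Plane → ℂ) : Prop where
  memLp : MemLp u 2 volume
  memLp_grad : ∀ i, MemLp (Du i) 2 volume
  weak_deriv : ∀ i, ∀ φ : Plane → ℝ, IsTestFunction φ →
    ∫ x, (partialDeriv i φ x : ℂ) * u x = - ∫ x, (φ x : ℂ) * Du i x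

/-- `∇ × A = ∂₁A₂ - ∂₂A₁ = B` in the sense of distributions. -/
def HasDistribCurl (A : Plane → Plane) (B : Plane → ℝ) : Prop :=
  ∀ φ : Plane → ℝ, IsTestFunction φ →
    ∫ x, (A x 0 * partialDeriv 1 φ x - A x 1 * partialDeriv 0 φ x) = ∫ x, B x * φ x

/-- The standing assumption on the magnetic field: `B ∈ L^p_loc(ℝ²)` for some `p > 2`, and
`|B(x)| = O(|x|^{-τ})` as `|x| → ∞` for some `τ > 2` (almost everywhere, as `B` is a class of
functions modulo null sets). -/
def FieldAssumption (B : Plane → ℝ) : Prop :=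
  (∃ p : ℝ≥0∞, 2 < p ∧ ∀ K : Set Plane, IsCompact K → MemLp B p (volume.restrict K)) ∧
  (∃ τ : ℝ, 2 < τ ∧ ∃ C R : ℝ, 0 < R ∧
    ∀ᵐ x : Plane, R ≤ ‖x‖ → |B x| ≤ C * ‖x‖ ^ (-τ))

/-- The normalized flux `α = (2π)⁻¹ ∫ B`. -/
noncomputable def flux (B : Plane → ℝ) : ℝ :=
  1 / (2 * Real.pi) * ∫ x, B x

/-- `μ_α = min_{m ∈ ℤ} |m - α|`, the distance from `α` to the integers. -/
noncomputable def distInt (α : ℝ) : ℝ :=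
  ⨅ m : ℤ, |(m : ℝ) - α|

/-- The logarithmic potential `h(x) = -(2π)⁻¹ ∫ B(y) log |x - y| dy`. -/
noncomputable def logPotential (B : Plane → ℝ) (x : Plane) : ℝ :=
  -(1 / (2 * Real.pi)) * ∫ y, B y * Real.log ‖x - y‖

/-- `g₊(ρ; r)`, equal to `1` for `r ≤ ρ` and to `ρ^{-α} r^α` for `r > ρ`. -/
noncomputable def gPlus (α ρ r : ℝ) : ℝ :=
  if r ≤ ρ then 1 else ρ ^ (-α) * r ^ α

/-- The quotient `e^{-h(x)} / g₊(ρ; |x|)`. -/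
noncomputable def ratioPlus (B : Plane → ℝ) (ρ : ℝ) (x : Plane) : ℝ :=
  Real.exp (-logPotential B x) / gPlus (flux B) ρ ‖x‖

/-- `k₊(ρ) = inf_x e^{-h(x)} / g₊(ρ; |x|)`. -/
noncomputable def kPlus (B : Plane → ℝ) (ρ : ℝ) : ℝ :=
  ⨅ x : Plane, ratioPlus B ρ x

/-- `K₊(ρ) = sup_x e^{-h(x)} / g₊(ρ; |x|)`. -/
noncomputable def KPlus (B : Plane → ℝ) (ρ : ℝ) : ℝ :=
  ⨆ x : Plane, ratioPlus B ρ x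

/-- `β₊(B; ρ) = (k₊(ρ) / K₊(ρ))²`. -/
noncomputable def betaPlus (B : Plane → ℝ) (ρ : ℝ) : ℝ :=
  (kPlus B ρ / KPlus B ρ) ^ 2

/-- The density `|(i∇ + A)u|² + B |u|²` of the spin-up Pauli form, for `u` with weak partial
derivatives `Du`. -/
noncomputable def pauliPlusDensity (A : Plane → Plane) (B : Plane → ℝ)
    (u : Plane → ℂ) (Du : Fin 2 → Plane → ℂ) (x : Plane) : ℝ :=
  (∑ j : Fin 2, ‖Complex.I * Du j x + (A x j : ℂ) * u x‖ ^ 2) + B x * ‖u x‖ ^ 2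

/-- The spin-up Pauli form `Q₊[u] = ∫ (|(i∇ + A)u|² + B |u|²) dx`. -/
noncomputable def pauliPlusForm (A : Plane → Plane) (B : Plane → ℝ)
    (u : Plane → ℂ) (Du : Fin 2 → Plane → ℂ) : ℝ :=
  ∫ x, pauliPlusDensity A B u Du x

end PauliHardy

/-!
Write `A = ∇^⊥ h + ∇χ`, which is possible since both sides have curl `B`, and substitute
`u = e^{-h+iχ} v`. Up to a null Lagrangian, `Q₊[u]` is the integral of `e^{-2h} |(∂₁ - i∂₂)v|²`.
As `e^{-h}` lies between `k₊ g₊` and `K₊ g₊`, the claim reduces to a Hardy inequality for the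
radial weight `g₊²`, at the price of the factor `β₊`. In polar coordinates that inequality follows
by completing the square. Outside the disc of radius `ρ` the gauged operator has angular spectrum
`{m - α}`, at distance `μ_α` from `0`. Inside the disc the multiplier comes from a subsolution of
the Riccati equation of the radial problem. The boundary terms at `r = ρ` have a sign because
`μ_α ≤ α`.

All this is done for mollified `A` and `h` and for smooth compactly supported `u`. Mollifying `h`
changes `k₊` and `K₊` only by factors that tend to `1`, because `log g₊(ρ; |x|)` is Lipschitz in
`x`. The passage to `u ∈ H¹(ℝ²)` uses Ladyzhenskaya's inequality to control `∫ B |u|²` with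
`B ∈ L²(ℝ²)`.
-/

namespace PauliHardy

open Complex (I)
open Filter
open Real (posLog)
open scoped Real Topology Function NNReal

section Circle

lemma distInt_le (α : ℝ) (m : ℤ) : distInt α ≤ |(m : ℝ) - α| :=
  ciInf_le ⟨0, by rintro _ ⟨m, rfl⟩; exact abs_nonneg _⟩ m

lemma distInt_nonneg (α : ℝ) : 0 ≤ distInt α :=
  Real.iInf_nonneg fun _ => abs_nonneg _

lemma distInt_le_half (α : ℝ) : distInt α ≤ 1 / 2 :=
  (distInt_le α (round α)).trans (by rw [abs_sub_comm]; exact abs_sub_round α)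

lemma distInt_le_abs (α : ℝ) : distInt α ≤ |α| := by
  simpa using distInt_le α 0

lemma fourierCoeffOn_eq_of_hasDerivAt {a b : ℝ} (hab : a < b) {f f' : ℝ → ℂ}
    (hf : ∀ θ, HasDerivAt f (f' θ) θ) (hf' : IntervalIntegrable f' volume a b) (hper : f b = f a)
    (n : ℤ) : (b - a) * fourierCoeffOn hab f' n = 2 * π * I * n * fourierCoeffOn hab f n := by
  rcases eq_or_ne n 0 with rfl | hn
  · have : ∫ θ in a..b, f' θ = 0 := by
      rw [intervalIntegral.integral_eq_sub_of_hasDerivAt (fun θ _ => hf θ) hf', hper, sub_self]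
    simp [fourierCoeffOn_eq_integral, this]
  · rw [fourierCoeffOn_of_hasDerivAt hab hn (fun θ _ => hf θ) hf', hper]
    have hn' : (n : ℂ) ≠ 0 := by exact_mod_cast hn
    have hπ : (π : ℂ) ≠ 0 := by exact_mod_cast Real.pi_ne_zero
    field_simp
    ring

lemma fourierCoeffOn_const_mul_sub_const_mul {a b : ℝ} (hab : a < b) {f g : ℝ → ℂ}
    (hf : IntervalIntegrable f volume a b) (hg : IntervalIntegrable g volume a b) (c d : ℂ)
    (n : ℤ) : fourierCoeffOn hab (fun θ => c * f θ - d * g θ) n =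
      c * fourierCoeffOn hab f n - d * fourierCoeffOn hab g n := by
  have hexp : Continuous fun x : ℝ => (fourier (-n) (x : AddCircle (b - a))) :=
    (map_continuous (fourier (-n))).comp (AddCircle.continuous_mk' _)
  have hinteg {k : ℝ → ℂ} (hk : IntervalIntegrable k volume a b) (c : ℂ) :
      IntervalIntegrable (fun θ : ℝ => c * (fourier (-n) (θ : AddCircle (b - a)) * k θ))
        volume a b :=
    (hk.continuousOn_mul hexp.continuousOn).const_mul c
  simp only [fourierCoeffOn_eq_integral, smul_eq_mul, Complex.real_smul]
  rw [mul_left_comm c, mul_left_comm d, ← mul_sub, ← intervalIntegral.integral_const_mul c,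
    ← intervalIntegral.integral_const_mul d,
    ← intervalIntegral.integral_sub (hinteg hf c) (hinteg hg d)]
  congr 1
  refine intervalIntegral.integral_congr fun θ _ => ?_
  ring

lemma fourierCoeffOn_momentum_sub {f f' : ℝ → ℂ} (hf : ∀ θ, HasDerivAt f (f' θ) θ)
    (hf' : Continuous f') (hper : f π = f (-π)) (α : ℝ) (n : ℤ) :
    fourierCoeffOn (neg_lt_self Real.pi_pos) (fun θ => -I * f' θ - α * f θ) n =
      ((n : ℝ) - α : ℝ) * fourierCoeffOn (neg_lt_self Real.pi_pos) f n := by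
  have hfc : Continuous f := continuous_iff_continuousAt.2 fun θ => (hf θ).continuousAt
  have hderiv : fourierCoeffOn (neg_lt_self Real.pi_pos) f' n =
      I * n * fourierCoeffOn (neg_lt_self Real.pi_pos) f n := by
    have h := fourierCoeffOn_eq_of_hasDerivAt (neg_lt_self Real.pi_pos) hf
      (hf'.intervalIntegrable _ _) hper n
    have hπ : (π : ℂ) ≠ 0 := by exact_mod_cast Real.pi_ne_zero
    push_cast at h
    refine mul_left_cancel₀ (mul_ne_zero two_ne_zero hπ) ?_
    linear_combination h
  rw [fourierCoeffOn_const_mul_sub_const_mul _ (hf'.intervalIntegrable _ _)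
    (hfc.intervalIntegrable _ _), hderiv]
  push_cast
  linear_combination (-(n : ℂ) * fourierCoeffOn (neg_lt_self Real.pi_pos) f n) * Complex.I_sq

/-- The eigenvalues of `-i d/dθ - α` on the circle are the numbers `n - α` with `n` an integer. -/
lemma distInt_sq_mul_integral_le {f f' : ℝ → ℂ} (hf : ∀ θ, HasDerivAt f (f' θ) θ)
    (hf' : Continuous f') (hper : f π = f (-π)) (α : ℝ) :
    distInt α ^ 2 * ∫ θ in (-π)..π, ‖f θ‖ ^ 2 ≤ ∫ θ in (-π)..π, ‖-I * f' θ - α * f θ‖ ^ 2 := by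
  have hfc : Continuous f := continuous_iff_continuousAt.2 fun θ => (hf θ).continuousAt
  have hL2 {k : ℝ → ℂ} (hk : Continuous k) : MemLp k 2 (volume.restrict (Set.Ioc (-π) π)) :=
    (memLp_two_iff_integrable_sq_norm hk.aestronglyMeasurable).2 (hk.norm.pow 2).integrableOn_Ioc
  have hπ : -π < π := neg_lt_self Real.pi_pos
  have hparseval := hasSum_le (fun n => ?_)
    ((hasSum_sq_fourierCoeffOn hπ (hL2 hfc)).mul_left (distInt α ^ 2))
    (hasSum_sq_fourierCoeffOn hπ (hL2 (by fun_prop : Continuous fun θ => -I * f' θ - α * f θ)))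
  · rw [smul_eq_mul, smul_eq_mul, mul_left_comm] at hparseval
    exact le_of_mul_le_mul_left hparseval (inv_pos.2 (sub_pos.2 hπ))
  · rw [fourierCoeffOn_momentum_sub hf hf' hper, norm_mul, mul_pow, Complex.norm_real,
      Real.norm_eq_abs]
    gcongr
    · exact distInt_nonneg α
    · exact distInt_le α n

end Circle

section Polar

variable {E F : Type*} [NormedAddCommGroup E] [NormedSpace ℝ E]
  [NormedAddCommGroup F] [InnerProductSpace ℝ F]

lemma hasDerivAt_intervalIntegral_param {f f' : ℝ → ℝ → E} {a b : ℝ}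
    (hf : Continuous ↿f) (hf' : Continuous ↿f') (hd : ∀ r θ, HasDerivAt (f · θ) (f' r θ) r)
    (r : ℝ) : HasDerivAt (fun s => ∫ θ in a..b, f s θ) (∫ θ in a..b, f' r θ) r := by
  have hc (s : ℝ) : Continuous (f s) := hf.comp (by fun_prop : Continuous fun θ => (s, θ))
  have hc' (s : ℝ) : Continuous (f' s) := hf'.comp (by fun_prop : Continuous fun θ => (s, θ))
  obtain ⟨C, hC⟩ := ((isCompact_closedBall r 1).prod (isCompact_uIcc (a := a) (b := b))
    ).exists_bound_of_continuousOn hf'.continuousOn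
  refine (intervalIntegral.hasDerivAt_integral_of_dominated_loc_of_deriv_le
    (bound := fun _ => C) (Metric.closedBall_mem_nhds r one_pos)
    (.of_forall fun s => (hc s).aestronglyMeasurable) ((hc r).intervalIntegrable _ _)
    (hc' r).aestronglyMeasurable (.of_forall fun θ hθ s hs => ?_) (by simp)
    (.of_forall fun θ _ s _ => hd s θ)).2
  exact hC (s, θ) ⟨hs, Set.uIoc_subset_uIcc hθ⟩

lemma continuous_intervalIntegral_param {f : ℝ → ℝ → E} {a b : ℝ} (hf : Continuous ↿f) :
    Continuous (fun s => ∫ θ in a..b, f s θ) :=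
  intervalIntegral.continuous_parametric_intervalIntegral_of_continuous' hf a b

lemma intervalIntegral_norm_add_smul_sq {f g : ℝ → F} (hf : Continuous f) (hg : Continuous g)
    (a b c : ℝ) :
    ∫ θ in a..b, ‖f θ + c • g θ‖ ^ 2 = (∫ θ in a..b, ‖f θ‖ ^ 2) +
      2 * c * (∫ θ in a..b, inner ℝ (f θ) (g θ)) + c ^ 2 * ∫ θ in a..b, ‖g θ‖ ^ 2 := by
  rw [← intervalIntegral.integral_const_mul, ← intervalIntegral.integral_const_mul,
    ← intervalIntegral.integral_add (Continuous.intervalIntegrable (by fun_prop) _ _)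
      (Continuous.intervalIntegrable (by fun_prop) _ _),
    ← intervalIntegral.integral_add (Continuous.intervalIntegrable (by fun_prop) _ _)
      (Continuous.intervalIntegrable (by fun_prop) _ _)]
  refine intervalIntegral.integral_congr fun θ _ => ?_
  simp only [norm_add_sq_real, real_inner_smul_right, norm_smul, mul_pow, Real.norm_eq_abs, sq_abs]
  ring

lemma real_inner_neg_I_mul_left (z w : ℂ) : inner ℝ (-I * z) w = -inner ℝ z (-I * w) := by
  simp only [Complex.inner, neg_mul, map_neg, map_mul, Complex.conj_I, Complex.neg_re,
    Complex.neg_im, Complex.mul_re, Complex.mul_im, Complex.conj_re, Complex.conj_im,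
    Complex.I_re, Complex.I_im]
  ring

lemma integral_inner_neg_I_mul_deriv_comm {a b : ℝ} {f g f' g' : ℝ → ℂ}
    (hf : ∀ θ, HasDerivAt f (f' θ) θ) (hg : ∀ θ, HasDerivAt g (g' θ) θ) (hf' : Continuous f')
    (hg' : Continuous g') (hfper : f b = f a) (hgper : g b = g a) :
    ∫ θ in a..b, inner ℝ (f θ) (-I * g' θ) = ∫ θ in a..b, inner ℝ (g θ) (-I * f' θ) := by
  have hfc : Continuous f := continuous_iff_continuousAt.2 fun θ => (hf θ).continuousAt
  have hgc : Continuous g := continuous_iff_continuousAt.2 fun θ => (hg θ).continuousAt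
  have hftc : ∫ θ in a..b, (inner ℝ (f θ) (-I * g' θ) + inner ℝ (f' θ) (-I * g θ)) = 0 := by
    rw [intervalIntegral.integral_eq_sub_of_hasDerivAt
      (fun θ _ => (hf θ).inner ℝ ((hg θ).const_mul (-I)))
      (Continuous.intervalIntegrable (by fun_prop) _ _), hfper, hgper, sub_self]
  rw [← sub_eq_zero, ← hftc, ← intervalIntegral.integral_sub
    (Continuous.intervalIntegrable (by fun_prop) _ _)
    (Continuous.intervalIntegrable (by fun_prop) _ _)]
  refine intervalIntegral.integral_congr fun θ _ => ?_
  simp only [real_inner_comm _ (g θ), real_inner_neg_I_mul_left (f' θ)]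
  ring

end Polar

section Angular

/-- The derivative `∂_r W` of a function `W r θ` of polar coordinates. -/
noncomputable def radialDeriv (W : ℝ → ℝ → ℂ) (r θ : ℝ) : ℂ := deriv (W · θ) r

/-- The angular momentum operator `-i ∂_θ` applied to a function `W r θ` of polar coordinates. -/
noncomputable def angularMomentum (W : ℝ → ℝ → ℂ) (r θ : ℝ) : ℂ := -I * deriv (W r) θ

/-- The squared `L²` norm of `W r` over one period of the angle. -/
noncomputable def circleNormSq (W : ℝ → ℝ → ℂ) (r : ℝ) : ℝ := ∫ θ in (-π)..π, ‖W r θ‖ ^ 2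

/-- The real `L²` inner product of `V r` and `W r` over one period of the angle. -/
noncomputable def circleInner (V W : ℝ → ℝ → ℂ) (r : ℝ) : ℝ :=
  ∫ θ in (-π)..π, inner ℝ (V r θ) (W r θ)

variable {V W : ℝ → ℝ → ℂ}

lemma circleNormSq_nonneg (W : ℝ → ℝ → ℂ) (r : ℝ) : 0 ≤ circleNormSq W r :=
  intervalIntegral.integral_nonneg (neg_le_self Real.pi_pos.le) fun _ _ => sq_nonneg _

lemma circleNormSq_eq_zero {r : ℝ} (h : ∀ θ, W r θ = 0) : circleNormSq W r = 0 := by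
  simp [circleNormSq, h]

lemma circleInner_eq_zero {r : ℝ} (h : ∀ θ, W r θ = 0) : circleInner V W r = 0 := by
  simp [circleInner, h]

lemma continuous_circleNormSq (hW : Continuous ↿W) : Continuous (circleNormSq W) :=
  continuous_intervalIntegral_param (f := fun r θ => ‖W r θ‖ ^ 2) (hW.norm.pow 2)

lemma continuous_circleInner (hV : Continuous ↿V) (hW : Continuous ↿W) :
    Continuous (circleInner V W) :=
  continuous_intervalIntegral_param (f := fun r θ => inner ℝ (V r θ) (W r θ)) (hV.inner hW)

lemma circleNormSq_add_mul (hV : Continuous ↿V) (hW : Continuous ↿W) (c r : ℝ) :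
    ∫ θ in (-π)..π, ‖V r θ + c * W r θ‖ ^ 2 =
      circleNormSq V r + 2 * c * circleInner V W r + c ^ 2 * circleNormSq W r := by
  simpa only [circleNormSq, circleInner, Complex.real_smul] using intervalIntegral_norm_add_smul_sq
    (Continuous.uncurry_left r hV) (Continuous.uncurry_left r hW) (-π) π c

lemma circleNormSq_add_mul_nonneg (hV : Continuous ↿V) (hW : Continuous ↿W) (c r : ℝ) :
    0 ≤ circleNormSq V r + 2 * c * circleInner V W r + c ^ 2 * circleNormSq W r := by
  rw [← circleNormSq_add_mul hV hW]
  exact circleNormSq_nonneg (fun r θ => V r θ + c * W r θ) r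

lemma fderiv_uncurry_apply_fst (hW : Differentiable ℝ ↿W) (r θ : ℝ) :
    fderiv ℝ ↿W (r, θ) (1, 0) = radialDeriv W r θ :=
  ((hW (r, θ)).hasFDerivAt.comp_hasDerivAt (f := fun s : ℝ => (s, θ)) r
    ((hasDerivAt_id r).prodMk (hasDerivAt_const r θ))).deriv.symm

lemma fderiv_uncurry_apply_snd (hW : Differentiable ℝ ↿W) (r θ : ℝ) :
    fderiv ℝ ↿W (r, θ) (0, 1) = deriv (W r) θ :=
  ((hW (r, θ)).hasFDerivAt.comp_hasDerivAt θ
    ((hasDerivAt_const θ r).prodMk (hasDerivAt_id θ))).deriv.symm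

lemma hasDerivAt_radialDeriv (hW : Differentiable ℝ ↿W) (r θ : ℝ) :
    HasDerivAt (W · θ) (radialDeriv W r θ) r :=
  ((hW (r, θ)).comp (f := fun s : ℝ => (s, θ)) r (by fun_prop)).hasDerivAt

lemma hasDerivAt_angular (hW : Differentiable ℝ ↿W) (r θ : ℝ) :
    HasDerivAt (W r) (deriv (W r) θ) θ :=
  ((hW (r, θ)).comp (f := fun s : ℝ => (r, s)) θ (by fun_prop)).hasDerivAt

lemma continuous_deriv_angular (hW : ContDiff ℝ 1 ↿W) (r : ℝ) : Continuous (deriv (W r)) := by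
  have h : deriv (W r) = fun θ => fderiv ℝ ↿W (r, θ) (0, 1) := funext fun θ =>
    (fderiv_uncurry_apply_snd (hW.differentiable one_ne_zero) r θ).symm
  rw [h]
  exact ((hW.continuous_fderiv one_ne_zero).comp (by fun_prop)).clm_apply continuous_const

lemma contDiff_radialDeriv {m n : ℕ∞ω} (hW : ContDiff ℝ n ↿W) (hmn : m + 1 ≤ n) :
    ContDiff ℝ m ↿(radialDeriv W) := by
  have h : ↿(radialDeriv W) = fun p => fderiv ℝ ↿W p (1, 0) := funext fun p =>
    (fderiv_uncurry_apply_fst (hW.differentiable (by rintro rfl; simp at hmn)) p.1 p.2).symm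
  rw [h]
  exact (hW.fderiv_right hmn).clm_apply contDiff_const

lemma contDiff_angularMomentum {m n : ℕ∞ω} (hW : ContDiff ℝ n ↿W) (hmn : m + 1 ≤ n) :
    ContDiff ℝ m ↿(angularMomentum W) := by
  have h : ↿(angularMomentum W) = fun p => -I * fderiv ℝ ↿W p (0, 1) := funext fun p => by
    rw [fderiv_uncurry_apply_snd (hW.differentiable (by rintro rfl; simp at hmn)) p.1 p.2]
    rfl
  rw [h]
  exact contDiff_const.mul ((hW.fderiv_right hmn).clm_apply contDiff_const)

lemma radialDeriv_angularMomentum (hW : ContDiff ℝ 2 ↿W) :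
    radialDeriv (angularMomentum W) = angularMomentum (radialDeriv W) := by
  have hd : Differentiable ℝ ↿W := hW.differentiable (by norm_num)
  have hdd : Differentiable ℝ (fderiv ℝ ↿W) :=
    (hW.fderiv_right (m := 1) (by norm_num)).differentiable one_ne_zero
  ext r θ
  have hrad : HasDerivAt (fun s => fderiv ℝ ↿W (s, θ) (0, 1))
      (fderiv ℝ (fderiv ℝ ↿W) (r, θ) (1, 0) (0, 1)) r := by
    simpa using ((hdd (r, θ)).hasFDerivAt.comp_hasDerivAt (f := fun s : ℝ => (s, θ)) r
      ((hasDerivAt_id r).prodMk (hasDerivAt_const r θ))).clm_apply (hasDerivAt_const r (0, 1))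
  have hang : HasDerivAt (fun s => fderiv ℝ ↿W (r, s) (1, 0))
      (fderiv ℝ (fderiv ℝ ↿W) (r, θ) (0, 1) (1, 0)) θ := by
    simpa using ((hdd (r, θ)).hasFDerivAt.comp_hasDerivAt (f := fun s : ℝ => (r, s)) θ
      ((hasDerivAt_const θ r).prodMk (hasDerivAt_id θ))).clm_apply (hasDerivAt_const θ (1, 0))
  have hsymm := (hW.contDiffAt.isSymmSndFDerivAt (x := (r, θ)) (by simp)).eq (1, 0) (0, 1)
  simp only [fderiv_uncurry_apply_snd hd] at hrad
  simp only [fderiv_uncurry_apply_fst hd] at hang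
  rw [radialDeriv, angularMomentum, hang.deriv, ← hsymm]
  exact (hrad.const_mul (-I)).deriv

lemma hasDerivAt_circleNormSq (hW : ContDiff ℝ 1 ↿W) (r : ℝ) :
    HasDerivAt (circleNormSq W) (2 * circleInner W (radialDeriv W) r) r := by
  have hc : Continuous ↿(radialDeriv W) :=
    (contDiff_radialDeriv (m := 0) hW (by norm_num)).continuous
  rw [circleInner, ← intervalIntegral.integral_const_mul]
  exact hasDerivAt_intervalIntegral_param (f := fun r θ => ‖W r θ‖ ^ 2)
    (f' := fun r θ => 2 * inner ℝ (W r θ) (radialDeriv W r θ)) (hW.continuous.norm.pow 2)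
    ((hW.continuous.inner hc).const_mul 2)
    (fun r θ => (hasDerivAt_radialDeriv (hW.differentiable one_ne_zero) r θ).norm_sq) r

lemma hasDerivAt_circleInner_angularMomentum (hW : ContDiff ℝ 2 ↿W)
    (hper : ∀ r, W r π = W r (-π)) (r : ℝ) :
    HasDerivAt (circleInner W (angularMomentum W))
      (2 * circleInner (radialDeriv W) (angularMomentum W) r) r := by
  have hd : Differentiable ℝ ↿W := hW.differentiable (by norm_num)
  have hR : ContDiff ℝ 1 ↿(radialDeriv W) := contDiff_radialDeriv hW (by norm_num)
  have hA : ContDiff ℝ 1 ↿(angularMomentum W) := contDiff_angularMomentum hW (by norm_num)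
  have hAR : Continuous ↿(angularMomentum (radialDeriv W)) :=
    (contDiff_angularMomentum (m := 0) hR (by norm_num)).continuous
  have hRper : radialDeriv W r π = radialDeriv W r (-π) := by
    simp only [radialDeriv, hper]
  have hslice {V : ℝ → ℝ → ℂ} (hV : Continuous ↿V) : Continuous (V r) :=
    Continuous.uncurry_left r hV
  have hsymm : circleInner W (angularMomentum (radialDeriv W)) r =
      circleInner (radialDeriv W) (angularMomentum W) r :=
    integral_inner_neg_I_mul_deriv_comm (hasDerivAt_angular hd r)
      (hasDerivAt_angular (hR.differentiable one_ne_zero) r)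
      (continuous_deriv_angular (hW.of_le (by norm_num)) r) (continuous_deriv_angular hR r)
      (hper r) hRper
  have hderiv := hasDerivAt_intervalIntegral_param (a := -π) (b := π)
    (f := fun r θ => inner ℝ (W r θ) (angularMomentum W r θ))
    (f' := fun r θ => inner ℝ (W r θ) (angularMomentum (radialDeriv W) r θ) +
      inner ℝ (radialDeriv W r θ) (angularMomentum W r θ))
    (hW.continuous.inner hA.continuous)
    ((hW.continuous.inner hAR).add (hR.continuous.inner hA.continuous))
    (fun r θ => by
      rw [← radialDeriv_angularMomentum hW]
      exact (hasDerivAt_radialDeriv hd r θ).inner ℝ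
        (hasDerivAt_radialDeriv (hA.differentiable one_ne_zero) r θ)) r
  refine hderiv.congr_deriv ?_
  rw [intervalIntegral.integral_add
    (((hslice hW.continuous).inner (hslice hAR)).intervalIntegrable _ _)
    (((hslice hR.continuous).inner (hslice hA.continuous)).intervalIntegrable _ _)]
  change circleInner W (angularMomentum (radialDeriv W)) r +
    circleInner (radialDeriv W) (angularMomentum W) r = _
  rw [hsymm, two_mul]

lemma distInt_sq_mul_circleNormSq_le (hW : ContDiff ℝ 1 ↿W) (hper : ∀ r, W r π = W r (-π))
    (α r : ℝ) :
    distInt α ^ 2 * circleNormSq W r ≤ circleNormSq (angularMomentum W) r -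
      2 * α * circleInner W (angularMomentum W) r + α ^ 2 * circleNormSq W r := by
  have hd : Differentiable ℝ ↿W := hW.differentiable one_ne_zero
  have hA : Continuous ↿(angularMomentum W) :=
    (contDiff_angularMomentum (m := 0) hW (by norm_num)).continuous
  refine (distInt_sq_mul_integral_le (hasDerivAt_angular hd r)
    (continuous_deriv_angular hW r) (hper r) α).trans_eq ?_
  have hexp := circleNormSq_add_mul hA hW.continuous (-α) r
  simp only [Complex.ofReal_neg, neg_mul, ← sub_eq_add_neg] at hexp
  have hcomm : circleInner (angularMomentum W) W r = circleInner W (angularMomentum W) r :=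
    intervalIntegral.integral_congr fun θ _ => real_inner_comm _ _
  rw [neg_sq, mul_neg, neg_mul, ← sub_eq_add_neg, hcomm] at hexp
  simpa only [angularMomentum, neg_mul] using hexp

end Angular

section Weight

variable {α ρ r : ℝ}

lemma gPlus_of_le (h : r ≤ ρ) : gPlus α ρ r = 1 := if_pos h

lemma gPlus_of_ge (hρ : 0 < ρ) (h : ρ ≤ r) : gPlus α ρ r = ρ ^ (-α) * r ^ α := by
  rcases h.eq_or_lt with rfl | h
  · rw [gPlus_of_le le_rfl, ← Real.rpow_add hρ, neg_add_cancel, Real.rpow_zero]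
  · exact if_neg h.not_ge

lemma gPlus_eq_max (hρ : 0 < ρ) : gPlus α ρ r = ρ ^ (-α) * (max ρ r) ^ α := by
  rcases le_total r ρ with h | h
  · rw [gPlus_of_le h, max_eq_left h, ← gPlus_of_ge hρ le_rfl, gPlus_of_le le_rfl]
  · rw [gPlus_of_ge hρ h, max_eq_right h]

lemma gPlus_pos (hρ : 0 < ρ) : 0 < gPlus α ρ r := by
  rw [gPlus_eq_max hρ]
  have : 0 < max ρ r := lt_max_of_lt_left hρ
  positivity

lemma continuous_gPlus (hρ : 0 < ρ) : Continuous (gPlus α ρ) := by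
  have : gPlus α ρ = fun r => ρ ^ (-α) * (max ρ r) ^ α := funext fun r => gPlus_eq_max hρ
  rw [this]
  exact continuous_const.mul ((continuous_const.max continuous_id).rpow_const fun r =>
    Or.inl (lt_max_of_lt_left hρ).ne')

lemma hasDerivAt_gPlus_sq_of_lt (hρ : 0 < ρ) (hr : ρ < r) :
    HasDerivAt (fun s => gPlus α ρ s ^ 2) (2 * α / r * gPlus α ρ r ^ 2) r := by
  have hr0 : 0 < r := hρ.trans hr
  have hpow := (((hasDerivAt_id r).rpow_const (p := α) (Or.inl hr0.ne')).const_mul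
    (ρ ^ (-α))).pow 2
  refine (hpow.congr_of_eventuallyEq ?_).congr_deriv ?_
  · filter_upwards [lt_mem_nhds hr] with s hs
    simp [gPlus_of_ge hρ hs.le]
  · simp only [id_eq, gPlus_of_ge hρ hr.le, Real.rpow_sub hr0, Real.rpow_one]
    field_simp
    push_cast
    ring

end Weight

section HardyPolar

/-- The squared `L²` norm of `∂_r W - (i / r) ∂_θ W` over one period of the angle; up to a phase,
`∂_r - (i / r) ∂_θ` is `∂₁ - i ∂₂` in polar coordinates. -/
noncomputable def circleWirtingerNormSq (W : ℝ → ℝ → ℂ) (r : ℝ) : ℝ :=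
  ∫ θ in (-π)..π, ‖radialDeriv W r θ + (r⁻¹ : ℝ) * angularMomentum W r θ‖ ^ 2

variable {W : ℝ → ℝ → ℂ}

lemma mul_circleWirtingerNormSq (hW : ContDiff ℝ 1 ↿W) {r : ℝ} (hr : r ≠ 0) :
    r * circleWirtingerNormSq W r = r * circleNormSq (radialDeriv W) r +
      circleNormSq (angularMomentum W) r / r +
      2 * circleInner (radialDeriv W) (angularMomentum W) r := by
  rw [circleWirtingerNormSq, circleNormSq_add_mul
    (contDiff_radialDeriv (m := 0) hW (by norm_num)).continuous
    (contDiff_angularMomentum (m := 0) hW (by norm_num)).continuous]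
  field_simp
  ring

/-- Completing the square in the radial derivative, with the multiplier `c / r`. -/
lemma neg_two_mul_circleInner_sub_le (hW : ContDiff ℝ 1 ↿W) {r : ℝ} (hr : 0 < r) (c : ℝ) :
    -(2 * c * circleInner W (radialDeriv W) r) - c ^ 2 / r * circleNormSq W r ≤
      r * circleNormSq (radialDeriv W) r := by
  have hR := (contDiff_radialDeriv (m := 0) hW (by norm_num)).continuous
  have hcomm : circleInner (radialDeriv W) W r = circleInner W (radialDeriv W) r :=
    intervalIntegral.integral_congr fun θ _ => real_inner_comm _ _
  have hsq := mul_nonneg hr.le (circleNormSq_add_mul_nonneg hR hW.continuous (c / r) r)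
  rw [hcomm] at hsq
  have hexp : r * (circleNormSq (radialDeriv W) r + 2 * (c / r) * circleInner W (radialDeriv W) r +
      (c / r) ^ 2 * circleNormSq W r) = r * circleNormSq (radialDeriv W) r +
      2 * c * circleInner W (radialDeriv W) r + c ^ 2 / r * circleNormSq W r := by
    field_simp
  linarith

/-- The multiplier used in the disc of radius `ρ`, a subsolution of the Riccati equation
associated with the radial part of the Hardy inequality. -/
noncomputable def discMultiplier (μ ρ r : ℝ) : ℝ := μ * r ^ 2 / (ρ ^ 2 + r ^ 2)

lemma hasDerivAt_discMultiplier {ρ : ℝ} (hρ : ρ ≠ 0) (μ r : ℝ) :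
    HasDerivAt (discMultiplier μ ρ) (2 * μ * r * ρ ^ 2 / (ρ ^ 2 + r ^ 2) ^ 2) r := by
  have hden : ρ ^ 2 + r ^ 2 ≠ 0 := by positivity
  refine ((((hasDerivAt_id r).pow 2).const_mul μ).div
    (((hasDerivAt_id r).pow 2).const_add (ρ ^ 2)) hden).congr_deriv ?_
  simp only [id_eq, Pi.pow_apply]
  congr 1
  push_cast
  ring

lemma discMultiplier_riccati {μ ρ r : ℝ} (hμ : 0 ≤ μ) (hμ2 : μ ≤ 1 / 2) (hr : 0 < r)
    (hrρ : r ≤ ρ) :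
    μ ^ 2 * (r / (ρ ^ 2 + r ^ 2)) ≤
      2 * μ * r * ρ ^ 2 / (ρ ^ 2 + r ^ 2) ^ 2 - discMultiplier μ ρ r ^ 2 / r := by
  have hden : ρ ^ 2 + r ^ 2 ≠ 0 := by positivity
  have hdiff : 2 * μ * r * ρ ^ 2 / (ρ ^ 2 + r ^ 2) ^ 2 - discMultiplier μ ρ r ^ 2 / r -
      μ ^ 2 * (r / (ρ ^ 2 + r ^ 2)) =
      μ * r / (ρ ^ 2 + r ^ 2) ^ 2 * (2 * ρ ^ 2 - μ * (ρ ^ 2 + 2 * r ^ 2)) := by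
    rw [discMultiplier]
    field_simp
    ring
  have hsq : r ^ 2 ≤ ρ ^ 2 := by gcongr
  rw [← sub_nonneg, hdiff]
  refine mul_nonneg (by positivity) ?_
  nlinarith [mul_nonneg (sub_nonneg.2 hμ2) (by positivity : 0 ≤ ρ ^ 2 + 2 * r ^ 2), sq_nonneg ρ]

lemma hardy_disc_integrand_le (hW : ContDiff ℝ 1 ↿W) {μ ρ r : ℝ} (hμ : 0 ≤ μ) (hμ2 : μ ≤ 1 / 2)
    (hr : 0 < r) (hrρ : r ≤ ρ) :
    2 * circleInner (radialDeriv W) (angularMomentum W) r -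
        (2 * μ * r * ρ ^ 2 / (ρ ^ 2 + r ^ 2) ^ 2 * circleNormSq W r +
          discMultiplier μ ρ r * (2 * circleInner W (radialDeriv W) r)) +
        μ ^ 2 * (r / (ρ ^ 2 + r ^ 2) * circleNormSq W r) ≤ r * circleWirtingerNormSq W r := by
  rw [mul_circleWirtingerNormSq hW hr.ne']
  have hsquare := neg_two_mul_circleInner_sub_le hW hr (discMultiplier μ ρ r)
  have hriccati := mul_le_mul_of_nonneg_right (discMultiplier_riccati hμ hμ2 hr hrρ)
    (circleNormSq_nonneg W r)
  have hang : 0 ≤ circleNormSq (angularMomentum W) r / r :=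
    div_nonneg (circleNormSq_nonneg _ r) hr.le
  linarith

lemma hardy_exterior_integrand_le (hW : ContDiff ℝ 1 ↿W) (hper : ∀ r, W r π = W r (-π))
    (α ρ : ℝ) {r : ℝ} (hr : 0 < r) :
    2 * α / r * (circleInner W (angularMomentum W) r - α * circleNormSq W r) +
        (2 * circleInner (radialDeriv W) (angularMomentum W) r -
          α * (2 * circleInner W (radialDeriv W) r)) +
        distInt α ^ 2 * (r / (ρ ^ 2 + r ^ 2) * circleNormSq W r) ≤
      r * circleWirtingerNormSq W r := by
  rw [mul_circleWirtingerNormSq hW hr.ne']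
  have hsquare := neg_two_mul_circleInner_sub_le hW hr α
  have hspectral := div_le_div_of_nonneg_right (distInt_sq_mul_circleNormSq_le hW hper α r) hr.le
  have hexpand : (circleNormSq (angularMomentum W) r -
      2 * α * circleInner W (angularMomentum W) r + α ^ 2 * circleNormSq W r) / r =
      circleNormSq (angularMomentum W) r / r -
        2 * α / r * (circleInner W (angularMomentum W) r - α * circleNormSq W r) -
        α ^ 2 / r * circleNormSq W r := by ring
  have hweight : r / (ρ ^ 2 + r ^ 2) ≤ 1 / r := by
    rw [div_le_div_iff₀ (by positivity) hr]
    nlinarith [sq_nonneg ρ]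
  have hmass := mul_le_mul_of_nonneg_left
    (mul_le_mul_of_nonneg_right hweight (circleNormSq_nonneg W r)) (sq_nonneg (distInt α))
  rw [hexpand] at hspectral
  have hdiv : distInt α ^ 2 * (1 / r * circleNormSq W r) =
    distInt α ^ 2 * circleNormSq W r / r := by ring
  linarith

variable {α ρ R : ℝ}

lemma continuous_hardy_weight (hρ : 0 < ρ) :
    Continuous fun r => gPlus α ρ r ^ 2 / (ρ ^ 2 + r ^ 2) := by
  have := continuous_gPlus (α := α) hρ
  fun_prop (disch := intro r; positivity)

lemma intervalIntegrable_hardy_mass (hW : Continuous ↿W) (hρ : 0 < ρ) (a b : ℝ) :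
    IntervalIntegrable
      (fun r => r * (gPlus α ρ r ^ 2 / (ρ ^ 2 + r ^ 2) * circleNormSq W r)) volume a b :=
  (continuous_id.mul ((continuous_hardy_weight hρ).mul
    (continuous_circleNormSq hW))).intervalIntegrable _ _

lemma intervalIntegrable_hardy_wirtinger (hρ : 0 < ρ) {a b : ℝ}
    (hT : IntervalIntegrable (fun r => r * circleWirtingerNormSq W r) volume a b) :
    IntervalIntegrable (fun r => r * (gPlus α ρ r ^ 2 * circleWirtingerNormSq W r)) volume a b := by
  have hg := ((continuous_gPlus (α := α) hρ).pow 2).continuousOn (s := Set.uIcc a b)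
  exact (hT.continuousOn_mul hg).congr fun r _ => mul_left_comm _ _ _

lemma hardy_disc (hW : ContDiff ℝ 2 ↿W) (hper : ∀ r, W r π = W r (-π))
    (hzero : ∀ θ, angularMomentum W 0 θ = 0) (hρ : 0 < ρ)
    (hT : IntervalIntegrable (fun r => r * circleWirtingerNormSq W r) volume 0 ρ) :
    circleInner W (angularMomentum W) ρ - distInt α / 2 * circleNormSq W ρ + distInt α ^ 2 *
        (∫ r in (0 : ℝ)..ρ, r * (gPlus α ρ r ^ 2 / (ρ ^ 2 + r ^ 2) * circleNormSq W r)) ≤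
      ∫ r in (0 : ℝ)..ρ, r * (gPlus α ρ r ^ 2 * circleWirtingerNormSq W r) := by
  set F := discMultiplier (distInt α) ρ with hF
  set F' : ℝ → ℝ := fun r => 2 * distInt α * r * ρ ^ 2 / (ρ ^ 2 + r ^ 2) ^ 2
  have hW1 : ContDiff ℝ 1 ↿W := hW.of_le (by norm_num)
  have hRc := (contDiff_radialDeriv (m := 0) hW1 (by norm_num)).continuous
  have hAc := (contDiff_angularMomentum (m := 0) hW1 (by norm_num)).continuous
  have cF : Continuous F :=
    continuous_iff_continuousAt.2 fun r => (hasDerivAt_discMultiplier hρ.ne' _ r).continuousAt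
  have cF' : Continuous F' := by
    fun_prop (disch := intro r; positivity)
  have cN := continuous_circleNormSq hW.continuous
  have cS := continuous_circleInner hW.continuous hRc
  have cK := continuous_circleInner hRc hAc
  have hinteg : IntervalIntegrable (fun r => 2 * circleInner (radialDeriv W) (angularMomentum W) r -
      (F' r * circleNormSq W r + F r * (2 * circleInner W (radialDeriv W) r))) volume 0 ρ :=
    Continuous.intervalIntegrable (by fun_prop) _ _
  have hftc := intervalIntegral.integral_eq_sub_of_hasDerivAt
    (fun r _ => (hasDerivAt_circleInner_angularMomentum hW hper r).sub
      ((hasDerivAt_discMultiplier hρ.ne' (distInt α) r).mul (hasDerivAt_circleNormSq hW1 r))) hinteg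
  have hboundary : circleInner W (angularMomentum W) ρ - distInt α / 2 * circleNormSq W ρ =
      (circleInner W (angularMomentum W) - F * circleNormSq W) ρ -
        (circleInner W (angularMomentum W) - F * circleNormSq W) 0 := by
    simp only [Pi.sub_apply, Pi.mul_apply, circleInner_eq_zero hzero, hF, discMultiplier]
    field_simp
    ring
  rw [hboundary, ← hftc, ← intervalIntegral.integral_const_mul, ← intervalIntegral.integral_add
    hinteg ((intervalIntegrable_hardy_mass hW.continuous hρ 0 ρ).const_mul _)]
  refine intervalIntegral.integral_mono_on_of_le_Ioo hρ.le
    (hinteg.add ((intervalIntegrable_hardy_mass hW.continuous hρ 0 ρ).const_mul _))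
    (intervalIntegrable_hardy_wirtinger hρ hT) ?_
  rintro r ⟨hr, hrρ⟩
  rw [gPlus_of_le hrρ.le]
  refine le_trans (le_of_eq ?_) ((hardy_disc_integrand_le hW1 (distInt_nonneg α)
    (distInt_le_half α) hr hrρ.le).trans_eq ?_) <;> ring

lemma hasDerivAt_gPlus_sq_mul (hW : ContDiff ℝ 2 ↿W) (hper : ∀ r, W r π = W r (-π)) (hρ : 0 < ρ)
    {r : ℝ} (hr : ρ < r) :
    HasDerivAt
      (fun r => gPlus α ρ r ^ 2 * (circleInner W (angularMomentum W) r - α * circleNormSq W r))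
      (gPlus α ρ r ^ 2 *
        (2 * α / r * (circleInner W (angularMomentum W) r - α * circleNormSq W r) +
          (2 * circleInner (radialDeriv W) (angularMomentum W) r -
            α * (2 * circleInner W (radialDeriv W) r)))) r := by
  refine ((hasDerivAt_gPlus_sq_of_lt hρ hr).mul
    ((hasDerivAt_circleInner_angularMomentum hW hper r).sub
      ((hasDerivAt_circleNormSq (hW.of_le (by norm_num)) r).const_mul α))).congr_deriv ?_
  simp only [Pi.sub_apply]
  ring

lemma hardy_exterior (hW : ContDiff ℝ 2 ↿W) (hper : ∀ r, W r π = W r (-π)) (hρ : 0 < ρ)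
    (hρR : ρ ≤ R) (hR : ∀ θ, W R θ = 0)
    (hT : IntervalIntegrable (fun r => r * circleWirtingerNormSq W r) volume ρ R) :
    -(circleInner W (angularMomentum W) ρ - α * circleNormSq W ρ) + distInt α ^ 2 *
        (∫ r in ρ..R, r * (gPlus α ρ r ^ 2 / (ρ ^ 2 + r ^ 2) * circleNormSq W r)) ≤
      ∫ r in ρ..R, r * (gPlus α ρ r ^ 2 * circleWirtingerNormSq W r) := by
  have hW1 : ContDiff ℝ 1 ↿W := hW.of_le (by norm_num)
  have hRc := (contDiff_radialDeriv (m := 0) hW1 (by norm_num)).continuous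
  have hAc := (contDiff_angularMomentum (m := 0) hW1 (by norm_num)).continuous
  have cg := continuous_gPlus (α := α) hρ
  have cN := continuous_circleNormSq hW.continuous
  have cJ := continuous_circleInner hW.continuous hAc
  have cS := continuous_circleInner hW.continuous hRc
  have cK := continuous_circleInner hRc hAc
  have hne : ∀ r ∈ Set.uIcc ρ R, r ≠ 0 := fun r hr =>
    (hρ.trans_le (Set.uIcc_of_le hρR ▸ hr).1).ne'
  have hinteg : IntervalIntegrable (fun r => gPlus α ρ r ^ 2 *
      (2 * α / r * (circleInner W (angularMomentum W) r - α * circleNormSq W r) +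
        (2 * circleInner (radialDeriv W) (angularMomentum W) r -
          α * (2 * circleInner W (radialDeriv W) r)))) volume ρ R :=
    ContinuousOn.intervalIntegrable (by fun_prop (disch := assumption))
  have hmass := intervalIntegrable_hardy_mass (α := α) hW.continuous hρ ρ R
  have hftc := intervalIntegral.integral_eq_sub_of_hasDerivAt_of_le hρR
    (Continuous.continuousOn (by fun_prop))
    (fun r hr => hasDerivAt_gPlus_sq_mul (α := α) hW hper hρ hr.1) hinteg
  have hJR : circleInner W (angularMomentum W) R = 0 := by simp [circleInner, hR]
  rw [hJR, circleNormSq_eq_zero hR, gPlus_of_le le_rfl, one_pow, one_mul, mul_zero, sub_zero,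
    mul_zero, zero_sub] at hftc
  rw [← hftc, ← intervalIntegral.integral_const_mul, ← intervalIntegral.integral_add
    hinteg (hmass.const_mul _)]
  refine intervalIntegral.integral_mono_on_of_le_Ioo hρR (hinteg.add (hmass.const_mul _))
    (intervalIntegrable_hardy_wirtinger hρ hT) ?_
  rintro r ⟨hrρ, -⟩
  have h := mul_le_mul_of_nonneg_left
    (hardy_exterior_integrand_le hW1 hper α ρ (hρ.trans hrρ)) (sq_nonneg (gPlus α ρ r))
  refine le_trans (le_of_eq ?_) (h.trans_eq ?_) <;> ring

/-- The boundary terms at `r = ρ` left over by the disc and by its exterior add up to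
`(α - distInt α / 2) * circleNormSq W ρ`, which is nonnegative. -/
lemma hardy_polar (hW : ContDiff ℝ 2 ↿W) (hper : ∀ r, W r π = W r (-π))
    (hzero : ∀ θ, angularMomentum W 0 θ = 0) (hα : 0 ≤ α) (hρ : 0 < ρ) (hρR : ρ ≤ R)
    (hR : ∀ θ, W R θ = 0)
    (hT : IntervalIntegrable (fun r => r * circleWirtingerNormSq W r) volume 0 R) :
    distInt α ^ 2 *
        (∫ r in (0 : ℝ)..R, r * (gPlus α ρ r ^ 2 / (ρ ^ 2 + r ^ 2) * circleNormSq W r)) ≤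
      ∫ r in (0 : ℝ)..R, r * (gPlus α ρ r ^ 2 * circleWirtingerNormSq W r) := by
  have hTdisc := hT.mono_set (Set.uIcc_subset_uIcc_left (Set.mem_uIcc_of_le hρ.le hρR))
  have hText := hT.mono_set (Set.uIcc_subset_uIcc_right (Set.mem_uIcc_of_le hρ.le hρR))
  rw [← intervalIntegral.integral_add_adjacent_intervals
      (intervalIntegrable_hardy_mass hW.continuous hρ 0 ρ)
      (intervalIntegrable_hardy_mass hW.continuous hρ ρ R),
    ← intervalIntegral.integral_add_adjacent_intervals
      (intervalIntegrable_hardy_wirtinger hρ hTdisc) (intervalIntegrable_hardy_wirtinger hρ hText)]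
  have hdisc := hardy_disc (α := α) hW hper hzero hρ hTdisc
  have hext := hardy_exterior (α := α) hW hper hρ hρR hR hText
  have hμα : distInt α ≤ α := (distInt_le_abs α).trans_eq (abs_of_nonneg hα)
  have hboundary : 0 ≤ (α - distInt α / 2) * circleNormSq W ρ :=
    mul_nonneg (by linarith [distInt_nonneg α]) (circleNormSq_nonneg W ρ)
  linarith

end HardyPolar

section PartialDerivatives

variable {E : Type*} [NormedAddCommGroup E] [NormedSpace ℝ E]

/-- The classical partial derivative of a function on the plane with values in a normed space;
for real functions it agrees with `partialDeriv`. -/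
noncomputable def pderiv (i : Fin 2) (f : Plane → E) (x : Plane) : E :=
  fderiv ℝ f x (EuclideanSpace.single i (1 : ℝ))

lemma partialDeriv_eq_pderiv (i : Fin 2) (φ : Plane → ℝ) : partialDeriv i φ = pderiv i φ := rfl

variable {f : Plane → E}

lemma contDiff_pderiv {n m : WithTop ℕ∞} (hf : ContDiff ℝ n f) (hmn : m + 1 ≤ n) (i : Fin 2) :
    ContDiff ℝ m (pderiv i f) :=
  (hf.fderiv_right hmn).clm_apply contDiff_const

lemma continuous_pderiv (hf : ContDiff ℝ 1 f) (i : Fin 2) : Continuous (pderiv i f) :=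
  (contDiff_pderiv (m := 0) hf (by norm_num) i).continuous

lemma hasCompactSupport_pderiv (hf : HasCompactSupport f) (i : Fin 2) :
    HasCompactSupport (pderiv i f) :=
  hf.fderiv_apply (𝕜 := ℝ) _

lemma pderiv_eq_zero_of_notMem_tsupport {x : Plane} (h : x ∉ tsupport f) (i : Fin 2) :
    pderiv i f x = 0 := by
  rw [pderiv, image_eq_zero_of_notMem_tsupport fun h' => h (tsupport_fderiv_subset ℝ h'),
    zero_apply]

lemma pderiv_eq_of_hasFDerivAt {f' : Plane →L[ℝ] E} {x : Plane} (h : HasFDerivAt f f' x)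
    (i : Fin 2) : pderiv i f x = f' (EuclideanSpace.single i 1) := by
  rw [pderiv, h.fderiv]

lemma plane_eq_add_smul_single (x : Plane) :
    x = x 0 • EuclideanSpace.single 0 (1 : ℝ) + x 1 • EuclideanSpace.single 1 (1 : ℝ) := by
  ext i
  fin_cases i <;> simp

lemma fderiv_apply_eq_add_smul_pderiv (f : Plane → E) (x y : Plane) :
    fderiv ℝ f x y = y 0 • pderiv 0 f x + y 1 • pderiv 1 f x := by
  conv_lhs => rw [plane_eq_add_smul_single y]
  rw [map_add, map_smul, map_smul]
  rfl

omit [NormedSpace ℝ E] in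
lemma exists_radius_notMem_tsupport (hf : HasCompactSupport f) (c : ℝ) :
    ∃ R, c < R ∧ ∀ x, R ≤ ‖x‖ → x ∉ tsupport f := by
  obtain ⟨R, hcR, hR⟩ := hf.isCompact.isBounded.subset_ball_lt c 0
  exact ⟨R, hcR, fun x hx hmem => (mem_ball_zero_iff.1 (hR hmem)).not_ge hx⟩

lemma integral_mul_pderiv {𝕜 : Type*} [RCLike 𝕜] {f g : Plane → 𝕜} (hf : ContDiff ℝ 1 f)
    (hg : ContDiff ℝ 1 g) (hgc : HasCompactSupport g) (i : Fin 2) :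
    ∫ x, f x * pderiv i g x = -∫ x, pderiv i f x * g x :=
  integral_mul_fderiv_eq_neg_fderiv_mul_of_integrable
    (((continuous_pderiv hf i).mul hg.continuous).integrable_of_hasCompactSupport hgc.mul_left)
    ((hf.continuous.mul (continuous_pderiv hg i)).integrable_of_hasCompactSupport
      (hasCompactSupport_pderiv hgc i).mul_left)
    ((hf.continuous.mul hg.continuous).integrable_of_hasCompactSupport hgc.mul_left)
    (fun x _ => hf.differentiable one_ne_zero x) (fun x _ => hg.differentiable one_ne_zero x)

end PartialDerivatives

section PolarCoordinates

lemma hasDerivAt_plane_of_apply {f : ℝ → Plane} {f' : Plane} {t : ℝ}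
    (h : ∀ i, HasDerivAt (f · i) (f' i) t) : HasDerivAt f f' t := by
  rw [hasDerivAt_iff_hasFDerivAt, ← hasFDerivWithinAt_univ, hasFDerivWithinAt_euclidean]
  intro i
  refine (h i).hasFDerivAt.hasFDerivWithinAt.congr_fderiv ?_
  ext
  simp

/-- The point of the plane with polar coordinates `(r, θ)`. -/
noncomputable def polarPt (r θ : ℝ) : Plane := !₂[r * Real.cos θ, r * Real.sin θ]

lemma contDiff_polarPt {n : WithTop ℕ∞} : ContDiff ℝ n ↿polarPt := by
  rw [contDiff_euclidean]
  intro i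
  fin_cases i
  · exact contDiff_fst.mul (Real.contDiff_cos.comp contDiff_snd)
  · exact contDiff_fst.mul (Real.contDiff_sin.comp contDiff_snd)

lemma norm_polarPt (r θ : ℝ) : ‖polarPt r θ‖ = |r| := by
  rw [EuclideanSpace.norm_eq, ← Real.sqrt_sq_eq_abs]
  congr 1
  simp only [polarPt, Fin.sum_univ_two, Real.norm_eq_abs, sq_abs, PiLp.toLp_apply,
    Matrix.cons_val_zero, Matrix.cons_val_one]
  linear_combination r ^ 2 * Real.sin_sq_add_cos_sq θ

lemma polarPt_zero (θ : ℝ) : polarPt 0 θ = 0 := by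
  rw [← norm_eq_zero, norm_polarPt, abs_zero]

lemma hasDerivAt_polarPt_left (r θ : ℝ) : HasDerivAt (polarPt · θ) (polarPt 1 θ) r := by
  refine hasDerivAt_plane_of_apply fun i => ?_
  fin_cases i
  · exact ((hasDerivAt_id r).mul_const _)
  · exact ((hasDerivAt_id r).mul_const _)

lemma hasDerivAt_polarPt_right (r θ : ℝ) :
    HasDerivAt (polarPt r) !₂[-(r * Real.sin θ), r * Real.cos θ] θ := by
  refine hasDerivAt_plane_of_apply fun i => ?_
  fin_cases i
  · exact ((Real.hasDerivAt_cos θ).const_mul r).congr_deriv (mul_neg _ _)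
  · exact (Real.hasDerivAt_sin θ).const_mul r

lemma integral_plane_eq_integral_prod (f : Plane → ℝ) :
    ∫ x, f x = ∫ p : ℝ × ℝ, f !₂[p.1, p.2] := by
  rw [← ((EuclideanSpace.volume_preserving_symm_measurableEquiv_toLp (Fin 2)).symm
      (MeasurableEquiv.toLp 2 (Fin 2 → ℝ)).symm).integral_comp' f,
    ← ((volume_preserving_finTwoArrow ℝ).symm MeasurableEquiv.finTwoArrow).integral_comp']
  rfl

lemma integral_eq_setIntegral_polarPt {f : Plane → ℝ} {R : ℝ} (hfR : ∀ x, R ≤ ‖x‖ → f x = 0) :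
    ∫ x, f x = ∫ p in Set.Ioc 0 R ×ˢ Set.Ioc (-π) π, p.1 * f (polarPt p.1 p.2) := by
  have hpolar : ∫ x, f x = ∫ p in polarCoord.target, p.1 * f (polarPt p.1 p.2) := by
    rw [integral_plane_eq_integral_prod, ← integral_comp_polarCoord_symm]
    rfl
  have hae : (Set.Ioc 0 R ×ˢ Set.Ioo (-π) π : Set (ℝ × ℝ)) =ᵐ[volume]
      (Set.Ioc 0 R ×ˢ Set.Ioc (-π) π : Set (ℝ × ℝ)) :=
    Measure.set_prod_ae_eq (ae_eq_refl _) Ioo_ae_eq_Ioc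
  rw [hpolar, ← setIntegral_congr_set hae, polarCoord_target]
  refine setIntegral_eq_of_subset_of_forall_sdiff_eq_zero (measurableSet_Ioi.prod measurableSet_Ioo)
    (Set.prod_mono Set.Ioc_subset_Ioi_self le_rfl) ?_
  rintro ⟨r, θ⟩ ⟨⟨hr, hθ⟩, hout⟩
  have hRr : R ≤ r := le_of_not_ge fun hle => hout ⟨⟨hr, hle⟩, hθ⟩
  rw [hfR, mul_zero]
  rw [norm_polarPt]
  exact hRr.trans (le_abs_self r)

lemma integral_eq_integral_polarPt {f : Plane → ℝ}
    (hf : Continuous fun p : ℝ × ℝ => p.1 * f (polarPt p.1 p.2)) {R : ℝ} (hR : 0 ≤ R)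
    (hfR : ∀ x, R ≤ ‖x‖ → f x = 0) :
    ∫ x, f x = ∫ r in (0 : ℝ)..R, r * ∫ θ in (-π)..π, f (polarPt r θ) := by
  have hinteg : IntegrableOn (fun p : ℝ × ℝ => p.1 * f (polarPt p.1 p.2))
      (Set.Ioc 0 R ×ˢ Set.Ioc (-π) π) :=
    (hf.continuousOn.integrableOn_compact (isCompact_Icc.prod isCompact_Icc)).mono_set
      (Set.prod_mono Set.Ioc_subset_Icc_self Set.Ioc_subset_Icc_self)
  rw [integral_eq_setIntegral_polarPt hfR, Measure.volume_eq_prod, setIntegral_prod _ hinteg,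
    intervalIntegral.integral_of_le hR]
  refine setIntegral_congr_fun measurableSet_Ioc fun r _ => ?_
  rw [intervalIntegral.integral_of_le (by linarith [Real.pi_pos]), integral_const_mul]

lemma integral_radial_mul {w : ℝ → ℝ} {f : Plane → ℝ} (hw : Continuous fun r => r * w |r|)
    (hf : Continuous f) {R : ℝ} (hR : 0 ≤ R) (hfR : ∀ x, R ≤ ‖x‖ → f x = 0) :
    ∫ x, w ‖x‖ * f x =
      ∫ r in (0 : ℝ)..R, r * (w r * ∫ θ in (-π)..π, f (polarPt r θ)) := by
  have hcont : Continuous fun p : ℝ × ℝ =>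
      p.1 * (w ‖polarPt p.1 p.2‖ * f (polarPt p.1 p.2)) := by
    simp only [norm_polarPt, ← mul_assoc]
    exact (hw.comp continuous_fst).mul (hf.comp (contDiff_polarPt (n := 0)).continuous)
  rw [integral_eq_integral_polarPt hcont hR fun x hx => by rw [hfR x hx, mul_zero]]
  refine intervalIntegral.integral_congr fun r hr => ?_
  rw [Set.uIcc_of_le hR] at hr
  simp only [norm_polarPt, abs_of_nonneg hr.1, intervalIntegral.integral_const_mul]

variable {E : Type*} [NormedAddCommGroup E] [NormedSpace ℝ E] {f : Plane → E}

lemma hasDerivAt_comp_polarPt_left (hf : Differentiable ℝ f) (r θ : ℝ) :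
    HasDerivAt (fun r => f (polarPt r θ))
      (Real.cos θ • pderiv 0 f (polarPt r θ) + Real.sin θ • pderiv 1 f (polarPt r θ)) r := by
  refine ((hf _).hasFDerivAt.comp_hasDerivAt r (hasDerivAt_polarPt_left r θ)).congr_deriv ?_
  simp [fderiv_apply_eq_add_smul_pderiv, polarPt]

lemma hasDerivAt_comp_polarPt_right (hf : Differentiable ℝ f) (r θ : ℝ) :
    HasDerivAt (fun θ => f (polarPt r θ))
      (-(r * Real.sin θ) • pderiv 0 f (polarPt r θ) +
        (r * Real.cos θ) • pderiv 1 f (polarPt r θ)) θ := by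
  refine ((hf _).hasFDerivAt.comp_hasDerivAt θ (hasDerivAt_polarPt_right r θ)).congr_deriv ?_
  simp [fderiv_apply_eq_add_smul_pderiv]

end PolarCoordinates

section HardySmooth

/-- The operator `∂₁ - i ∂₂`, that is, twice the Wirtinger derivative `∂_z`. -/
noncomputable def wirtingerDeriv (v : Plane → ℂ) (x : Plane) : ℂ := pderiv 0 v x - I * pderiv 1 v x

variable {v : Plane → ℂ}

lemma circleWirtingerNormSq_comp_polarPt (hv : Differentiable ℝ v) {r : ℝ} (hr : r ≠ 0) :
    circleWirtingerNormSq (fun r θ => v (polarPt r θ)) r =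
      ∫ θ in (-π)..π, ‖wirtingerDeriv v (polarPt r θ)‖ ^ 2 := by
  refine intervalIntegral.integral_congr fun θ _ => ?_
  have hphase : radialDeriv (fun r θ => v (polarPt r θ)) r θ +
      (r⁻¹ : ℝ) * angularMomentum (fun r θ => v (polarPt r θ)) r θ =
      Complex.exp (θ * I) * wirtingerDeriv v (polarPt r θ) := by
    have hr' : (r : ℂ) ≠ 0 := by exact_mod_cast hr
    rw [radialDeriv, angularMomentum, (hasDerivAt_comp_polarPt_left hv r θ).deriv,
      (hasDerivAt_comp_polarPt_right hv r θ).deriv, wirtingerDeriv, Complex.exp_mul_I]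
    simp only [Complex.real_smul]
    push_cast
    field_simp
    linear_combination (Complex.sin θ * pderiv 1 v (polarPt r θ)) * Complex.I_sq
  simp only [hphase, norm_mul, Complex.norm_exp_ofReal_mul_I, one_mul]

lemma continuous_wirtingerDeriv (hv : ContDiff ℝ 1 v) : Continuous (wirtingerDeriv v) :=
  (continuous_pderiv hv 0).sub (continuous_const.mul (continuous_pderiv hv 1))

lemma wirtingerDeriv_eq_zero_of_notMem_tsupport {x : Plane} (h : x ∉ tsupport v) :
    wirtingerDeriv v x = 0 := by
  simp [wirtingerDeriv, pderiv_eq_zero_of_notMem_tsupport h]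

lemma hardy_smooth (hv : ContDiff ℝ 2 v) (hvc : HasCompactSupport v) {α ρ : ℝ} (hα : 0 ≤ α)
    (hρ : 0 < ρ) :
    distInt α ^ 2 * (∫ x, gPlus α ρ ‖x‖ ^ 2 / (ρ ^ 2 + ‖x‖ ^ 2) * ‖v x‖ ^ 2) ≤
      ∫ x, gPlus α ρ ‖x‖ ^ 2 * ‖wirtingerDeriv v x‖ ^ 2 := by
  obtain ⟨R, hρR, hR⟩ := exists_radius_notMem_tsupport hvc ρ
  have hR0 : 0 ≤ R := (hρ.trans hρR).le
  have hv1 : ContDiff ℝ 1 v := hv.of_le (by norm_num)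
  have hvR : ∀ x, R ≤ ‖x‖ → v x = 0 := fun x hx => image_eq_zero_of_notMem_tsupport (hR x hx)
  have hwR : ∀ x, R ≤ ‖x‖ → wirtingerDeriv v x = 0 := fun x hx =>
    wirtingerDeriv_eq_zero_of_notMem_tsupport (hR x hx)
  have cv := hv.continuous
  have cw := continuous_wirtingerDeriv hv1
  have hdbar : Set.EqOn
      (fun r => r * ∫ θ in (-π)..π, ‖wirtingerDeriv v (polarPt r θ)‖ ^ 2)
      (fun r => r * circleWirtingerNormSq (fun r θ => v (polarPt r θ)) r) (Set.uIoc 0 R) :=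
    fun r hr => by
      rw [Set.uIoc_of_le hR0] at hr
      simp only [circleWirtingerNormSq_comp_polarPt (hv1.differentiable one_ne_zero) hr.1.ne']
  have hcont : Continuous fun r => r * ∫ θ in (-π)..π, ‖wirtingerDeriv v (polarPt r θ)‖ ^ 2 :=
    continuous_id.mul (continuous_intervalIntegral_param
      ((cw.comp (contDiff_polarPt (n := 0)).continuous).norm.pow 2))
  have hpolar := hardy_polar (α := α) (W := fun r θ => v (polarPt r θ)) (hv.comp contDiff_polarPt)
    (fun r => by simp [polarPt]) (fun θ => by simp [angularMomentum, polarPt_zero]) hα hρ hρR.le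
    (fun θ => hvR _ (by rw [norm_polarPt]; exact le_abs_self R))
    ((hcont.intervalIntegrable 0 R).congr hdbar)
  have cg := continuous_gPlus (α := α) hρ
  have cw' := continuous_hardy_weight (α := α) hρ
  rw [integral_radial_mul (w := fun r => gPlus α ρ r ^ 2 / (ρ ^ 2 + r ^ 2))
      (f := fun x => ‖v x‖ ^ 2) (continuous_id.mul (cw'.comp continuous_abs)) (by fun_prop) hR0
      (fun x hx => by simp [hvR x hx]),
    integral_radial_mul (w := fun r => gPlus α ρ r ^ 2) (f := fun x => ‖wirtingerDeriv v x‖ ^ 2)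
      (by fun_prop) (by fun_prop) hR0 (fun x hx => by simp [hwR x hx])]
  refine hpolar.trans_eq (intervalIntegral.integral_congr_ae (.of_forall fun r hr => ?_))
  have := hdbar hr
  simp only at this
  rw [mul_left_comm, ← this, mul_left_comm]

end HardySmooth

section Laplacian

variable {φ : Plane → ℝ}

lemma continuous_laplacian (hφ : ContDiff ℝ 2 φ) :
    Continuous fun x => ∑ i, pderiv i (pderiv i φ) x :=
  continuous_finsetSum _ fun i _ =>
    continuous_pderiv (contDiff_pderiv hφ (by norm_num) i) i

lemma hasCompactSupport_laplacian (hφc : HasCompactSupport φ) :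
    HasCompactSupport fun x => ∑ i, pderiv i (pderiv i φ) x := by
  have h (i : Fin 2) := hasCompactSupport_pderiv (hasCompactSupport_pderiv hφc i) i
  simp only [Fin.sum_univ_two]
  exact (h 0).add (h 1)

/-- The integral over the circle of radius `r` of the radial derivative of `φ`. -/
noncomputable def circleRadialDeriv (φ : Plane → ℝ) (r : ℝ) : ℝ :=
  ∫ θ in (-π)..π,
    (Real.cos θ * pderiv 0 φ (polarPt r θ) + Real.sin θ * pderiv 1 φ (polarPt r θ))

lemma hasDerivAt_integral_comp_polarPt (hφ : ContDiff ℝ 1 φ) (r : ℝ) :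
    HasDerivAt (fun r => ∫ θ in (-π)..π, φ (polarPt r θ)) (circleRadialDeriv φ r) r := by
  have cφ := hφ.continuous
  have cd := continuous_pderiv hφ
  have cP := contDiff_polarPt (n := 0).continuous
  exact hasDerivAt_intervalIntegral_param (f := fun r θ => φ (polarPt r θ))
    (f' := fun r θ =>
      Real.cos θ * pderiv 0 φ (polarPt r θ) + Real.sin θ * pderiv 1 φ (polarPt r θ))
    (by fun_prop) (by fun_prop)
    (hasDerivAt_comp_polarPt_left (hφ.differentiable one_ne_zero)) r

/-- The second radial derivative `(cos θ ∂₁ + sin θ ∂₂)² φ` at the point with polar coordinates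
`(r, θ)`. -/
noncomputable def radialHessian (φ : Plane → ℝ) (r θ : ℝ) : ℝ :=
  Real.cos θ * (Real.cos θ • pderiv 0 (pderiv 0 φ) (polarPt r θ) +
    Real.sin θ • pderiv 1 (pderiv 0 φ) (polarPt r θ)) +
  Real.sin θ * (Real.cos θ • pderiv 0 (pderiv 1 φ) (polarPt r θ) +
    Real.sin θ • pderiv 1 (pderiv 1 φ) (polarPt r θ))

lemma continuous_radialHessian (hφ : ContDiff ℝ 2 φ) : Continuous ↿(radialHessian φ) := by
  have c2 (i j) := continuous_pderiv (contDiff_pderiv hφ (m := 1) (by norm_num) i) j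
  have cP := contDiff_polarPt (n := 0).continuous
  unfold radialHessian
  fun_prop

lemma hasDerivAt_circleRadialDeriv (hφ : ContDiff ℝ 2 φ) (r : ℝ) :
    HasDerivAt (circleRadialDeriv φ) (∫ θ in (-π)..π, radialHessian φ r θ) r := by
  have hφ' (i) : ContDiff ℝ 1 (pderiv i φ) := contDiff_pderiv hφ (by norm_num) i
  have c1 (i) := (hφ' i).continuous
  have cP := contDiff_polarPt (n := 0).continuous
  have hd (i) := hasDerivAt_comp_polarPt_left ((hφ' i).differentiable one_ne_zero)
  exact hasDerivAt_intervalIntegral_param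
    (f := fun r θ =>
      Real.cos θ * pderiv 0 φ (polarPt r θ) + Real.sin θ * pderiv 1 φ (polarPt r θ))
    (by fun_prop) (continuous_radialHessian hφ)
    (fun r θ => ((hd 0 r θ).const_mul _).add ((hd 1 r θ).const_mul _)) r

lemma hasDerivAt_tangentialDeriv (hφ : ContDiff ℝ 2 φ) (r θ : ℝ) :
    HasDerivAt
      (fun θ => Real.cos θ * pderiv 1 φ (polarPt r θ) - Real.sin θ * pderiv 0 φ (polarPt r θ))
      (r * ∑ i, pderiv i (pderiv i φ) (polarPt r θ) -
        ((Real.cos θ * pderiv 0 φ (polarPt r θ) + Real.sin θ * pderiv 1 φ (polarPt r θ)) +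
          r * radialHessian φ r θ)) θ := by
  have hφ' (i) : ContDiff ℝ 1 (pderiv i φ) := contDiff_pderiv hφ (by norm_num) i
  have h (i) := hasDerivAt_comp_polarPt_right ((hφ' i).differentiable one_ne_zero) r θ
  refine (((Real.hasDerivAt_cos θ).mul (h 1)).sub
    ((Real.hasDerivAt_sin θ).mul (h 0))).congr_deriv ?_
  simp only [radialHessian, Fin.sum_univ_two, smul_eq_mul]
  linear_combination r * (pderiv 0 (pderiv 0 φ) (polarPt r θ) +
    pderiv 1 (pderiv 1 φ) (polarPt r θ)) * Real.sin_sq_add_cos_sq θ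

/- In polar coordinates `r Δφ = ∂_r (r ∂_r φ) + ∂_θ q`, where `q = -sin θ ∂₁φ + cos θ ∂₂φ` is
periodic in `θ`. -/
lemma hasDerivAt_mul_circleRadialDeriv (hφ : ContDiff ℝ 2 φ) (r : ℝ) :
    HasDerivAt (fun r => r * circleRadialDeriv φ r)
      (r * ∫ θ in (-π)..π, ∑ i, pderiv i (pderiv i φ) (polarPt r θ)) r := by
  have c1 := continuous_pderiv (hφ.of_le one_le_two)
  have cP : Continuous (polarPt r) :=
    (contDiff_polarPt (n := 0).continuous).comp (by fun_prop : Continuous fun θ => (r, θ))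
  have cL : Continuous fun θ => r * ∑ i, pderiv i (pderiv i φ) (polarPt r θ) :=
    continuous_const.mul ((continuous_laplacian hφ).comp cP)
  have cR : Continuous fun θ =>
      Real.cos θ * pderiv 0 φ (polarPt r θ) + Real.sin θ * pderiv 1 φ (polarPt r θ) := by
    fun_prop
  have cH : Continuous fun θ => r * radialHessian φ r θ :=
    continuous_const.mul (Continuous.uncurry_left r (continuous_radialHessian hφ))
  have hq := intervalIntegral.integral_eq_sub_of_hasDerivAt
    (fun θ _ => hasDerivAt_tangentialDeriv hφ r θ)
    ((cL.sub (cR.fun_add cH)).intervalIntegrable (-π) π)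
  rw [intervalIntegral.integral_sub (cL.intervalIntegrable _ _)
      ((cR.fun_add cH).intervalIntegrable _ _),
    intervalIntegral.integral_add (cR.intervalIntegrable _ _) (cH.intervalIntegrable _ _),
    intervalIntegral.integral_const_mul, intervalIntegral.integral_const_mul] at hq
  have hperiodic : polarPt r (-π) = polarPt r π := by simp [polarPt]
  simp only [hperiodic, Real.cos_neg, Real.sin_neg, Real.sin_pi, neg_zero, sub_self] at hq
  refine ((hasDerivAt_id r).mul (hasDerivAt_circleRadialDeriv hφ r)).congr_deriv ?_
  simp only [id, circleRadialDeriv]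
  linarith

lemma integral_log_mul_integral_laplacian (hφ : ContDiff ℝ 2 φ) {R : ℝ} (hR : 0 ≤ R) :
    ∫ r in (0 : ℝ)..R,
        r * (Real.log r * ∫ θ in (-π)..π, ∑ i, pderiv i (pderiv i φ) (polarPt r θ)) =
      R * Real.log R * circleRadialDeriv φ R - (∫ θ in (-π)..π, φ (polarPt R θ)) +
        2 * π * φ 0 := by
  set m : ℝ → ℝ := fun r => ∫ θ in (-π)..π, φ (polarPt r θ)
  set L : ℝ → ℝ := fun r => ∫ θ in (-π)..π, ∑ i, pderiv i (pderiv i φ) (polarPt r θ)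
  have cP := contDiff_polarPt (n := 0).continuous
  have cL : Continuous L :=
    continuous_intervalIntegral_param (f := fun r θ => ∑ i, pderiv i (pderiv i φ) (polarPt r θ))
      ((continuous_laplacian hφ).comp cP)
  have cm' : Continuous (circleRadialDeriv φ) := by
    have c (i) := continuous_pderiv (hφ.of_le one_le_two) i
    exact continuous_intervalIntegral_param (f := fun r θ =>
      Real.cos θ * pderiv 0 φ (polarPt r θ) + Real.sin θ * pderiv 1 φ (polarPt r θ))
      (by fun_prop)
  have hm (r) : HasDerivAt m (circleRadialDeriv φ r) r :=
    hasDerivAt_integral_comp_polarPt (hφ.of_le one_le_two) r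
  have cm : Continuous m := continuous_iff_continuousAt.2 fun r => (hm r).continuousAt
  set F : ℝ → ℝ := fun r => r * Real.log r * circleRadialDeriv φ r - m r with hF
  have cF : Continuous F := (Real.continuous_mul_log.mul cm').sub cm
  have hFd (r) (hr : r ∈ Set.Ioo 0 R) : HasDerivAt F (r * (Real.log r * L r)) r := by
    refine (((Real.hasDerivAt_log hr.1.ne').mul
      (hasDerivAt_mul_circleRadialDeriv hφ r)).sub (hm r)).congr_of_eventuallyEq
      (.of_forall fun s => ?_) |>.congr_deriv ?_
    · simp only [hF, Pi.sub_apply, Pi.mul_apply]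
      ring
    · rw [inv_mul_cancel_left₀ hr.1.ne']
      ring
  have cF' : Continuous fun r => r * (Real.log r * L r) := by
    simp only [← mul_assoc]
    exact Real.continuous_mul_log.mul cL
  rw [intervalIntegral.integral_eq_sub_of_hasDerivAt_of_le hR cF.continuousOn hFd
    (cF'.intervalIntegrable _ _)]
  simp only [hF, m, polarPt_zero, intervalIntegral.integral_const, smul_eq_mul]
  ring

lemma integral_log_norm_mul_laplacian (hφ : ContDiff ℝ 2 φ) (hφc : HasCompactSupport φ) :
    ∫ x, Real.log ‖x‖ * ∑ i, pderiv i (pderiv i φ) x = 2 * π * φ 0 := by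
  obtain ⟨R, hR0, hR⟩ := exists_radius_notMem_tsupport hφc 0
  have hRn (θ) : polarPt R θ ∉ tsupport φ :=
    hR _ ((norm_polarPt R θ).symm ▸ le_abs_self R)
  rw [integral_radial_mul (by simpa only [Real.log_abs] using Real.continuous_mul_log)
    (continuous_laplacian hφ) hR0.le fun x hx => ?_, integral_log_mul_integral_laplacian hφ hR0.le]
  · simp [circleRadialDeriv, image_eq_zero_of_notMem_tsupport (hRn _),
      pderiv_eq_zero_of_notMem_tsupport (hRn _)]
  · exact Finset.sum_eq_zero fun i _ => pderiv_eq_zero_of_notMem_tsupport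
      (fun h => hR x hx (tsupport_fderiv_apply_subset ℝ _ h)) i

lemma integral_log_norm_sub_mul_laplacian (hφ : ContDiff ℝ 2 φ) (hφc : HasCompactSupport φ)
    (y : Plane) :
    ∫ x, Real.log ‖x - y‖ * ∑ i, pderiv i (pderiv i φ) x = 2 * π * φ y := by
  have hp (i : Fin 2) (f : Plane → ℝ) :
      pderiv i (fun x => f (x + y)) = fun x => pderiv i f (x + y) :=
    funext fun x => by simp only [pderiv, fderiv_comp_add_right]
  have h := integral_log_norm_mul_laplacian (φ := fun x => φ (x + y))
    (hφ.comp (contDiff_id.add contDiff_const)) (hφc.comp_homeomorph (Homeomorph.addRight y))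
  simp only [hp, zero_add] at h
  rw [← integral_add_right_eq_self _ y]
  simpa only [add_sub_cancel_right] using h

end Laplacian

section Decay

variable {E F : Type*} [NormedAddCommGroup E] [NormedSpace ℝ E] [FiniteDimensional ℝ E]
  [MeasurableSpace E] [BorelSpace E] {μ : Measure E} [μ.IsAddHaarMeasure] [NormedAddCommGroup F]

lemma integrable_of_norm_le_mul_rpow_neg {f : E → F} (hf : LocallyIntegrable f μ) {τ C R : ℝ}
    (hτ : Module.finrank ℝ E < τ) (hdecay : ∀ᵐ x ∂μ, R ≤ ‖x‖ → ‖f x‖ ≤ C * ‖x‖ ^ (-τ)) :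
    Integrable f μ := by
  refine integrable_iff_integrableAtFilter_cocompact.2
    ⟨⟨(Metric.closedBall 0 (max R 1))ᶜ, (isCompact_closedBall _ _).compl_mem_cocompact, ?_⟩, hf⟩
  refine ((integrable_one_add_norm hτ).const_mul (|C| * 2 ^ τ)).integrableOn.mono'
    hf.aestronglyMeasurable.restrict ?_
  refine (ae_restrict_iff' Metric.isClosed_closedBall.measurableSet.compl).2 ?_
  filter_upwards [hdecay] with x hx hxR
  obtain ⟨hRx, h1x⟩ : R < ‖x‖ ∧ 1 < ‖x‖ := by simpa using hxR
  have hτ0 : 0 ≤ τ := (Nat.cast_nonneg _).trans hτ.le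
  have key : (‖x‖ : ℝ) ^ (-τ) ≤ 2 ^ τ * (1 + ‖x‖) ^ (-τ) := by
    rw [Real.rpow_neg (by positivity), Real.rpow_neg (by positivity), ← div_eq_mul_inv,
      ← Real.div_rpow zero_le_two (by positivity), ← Real.inv_rpow (by positivity)]
    refine Real.rpow_le_rpow (by positivity) ?_ hτ0
    rw [le_div_iff₀ (by positivity), inv_mul_le_iff₀ (by positivity)]
    linarith
  calc ‖f x‖ ≤ C * ‖x‖ ^ (-τ) := hx hRx.le
    _ ≤ |C| * (2 ^ τ * (1 + ‖x‖) ^ (-τ)) := by gcongr; exact le_abs_self C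
    _ = |C| * 2 ^ τ * (1 + ‖x‖) ^ (-τ) := (mul_assoc _ _ _).symm

end Decay

lemma continuous_posLog_norm : Continuous fun x : Plane => posLog ‖x‖ :=
  Real.continuous_posLog.comp continuous_norm

/-- The integrability properties of the magnetic field under which its logarithmic potential
satisfies `-h(x) = α log |x| + O(1)`. -/
structure IsIntegrableField (B : Plane → ℝ) : Prop where
  integrable : Integrable B
  integrable_sq : Integrable fun y => B y ^ 2
  integrable_mul_posLog : Integrable fun y => B y * posLog ‖y‖

lemma FieldAssumption.isIntegrableField {B : Plane → ℝ} (hB : FieldAssumption B) :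
    IsIntegrableField B := by
  obtain ⟨⟨p, hp, hpB⟩, τ, hτ, C, R, hR, hdec⟩ := hB
  have hL2 (K : Set Plane) (hK : IsCompact K) : MemLp B 2 (volume.restrict K) :=
    have := isFiniteMeasure_restrict.2 (hK.measure_lt_top (μ := volume)).ne
    (hpB K hK).mono_exponent hp.le
  have hL1 (K : Set Plane) (hK : IsCompact K) : IntegrableOn B K :=
    have := isFiniteMeasure_restrict.2 (hK.measure_lt_top (μ := volume)).ne
    (hL2 K hK).integrable one_le_two
  have hdim {s : ℝ} (hs : 2 < s) : (Module.finrank ℝ Plane : ℝ) < s := by simpa using hs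
  refine ⟨integrable_of_norm_le_mul_rpow_neg (locallyIntegrable_iff.2 hL1) (hdim hτ) hdec,
    integrable_of_norm_le_mul_rpow_neg (τ := 2 * τ) (C := C ^ 2) (R := R)
      (locallyIntegrable_iff.2 fun K hK => (hL2 K hK).integrable_sq) (hdim (by linarith)) ?_,
    integrable_of_norm_le_mul_rpow_neg (τ := τ - (τ - 2) / 2) (C := C / ((τ - 2) / 2)) (R := R)
      (locallyIntegrable_iff.2 fun K hK =>
        (hL1 K hK).mul_continuousOn continuous_posLog_norm.continuousOn hK)
      (hdim (by linarith)) ?_⟩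
  · filter_upwards [hdec] with x hx hxR
    rw [norm_pow, Real.norm_eq_abs]
    calc |B x| ^ 2 ≤ (C * ‖x‖ ^ (-τ)) ^ 2 := by gcongr; exact hx hxR
      _ = C ^ 2 * ‖x‖ ^ (-(2 * τ)) := by
        rw [mul_pow, ← Real.rpow_mul_natCast (norm_nonneg x)]
        congr 2
        push_cast
        ring
  · filter_upwards [hdec] with x hx hxR
    have hx0 : 0 < ‖x‖ := hR.trans_le hxR
    have hε : 0 < (τ - 2) / 2 := by linarith
    have hlog : posLog ‖x‖ ≤ ‖x‖ ^ ((τ - 2) / 2) / ((τ - 2) / 2) :=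
      max_le (by positivity) (Real.log_le_rpow_div hx0.le hε)
    rw [norm_mul, Real.norm_eq_abs, Real.norm_of_nonneg Real.posLog_nonneg]
    calc |B x| * posLog ‖x‖
        ≤ (C * ‖x‖ ^ (-τ)) * (‖x‖ ^ ((τ - 2) / 2) / ((τ - 2) / 2)) :=
          mul_le_mul (hx hxR) hlog Real.posLog_nonneg ((abs_nonneg _).trans (hx hxR))
      _ = C / ((τ - 2) / 2) * (‖x‖ ^ (-τ) * ‖x‖ ^ ((τ - 2) / 2)) := by ring
      _ = C / ((τ - 2) / 2) * ‖x‖ ^ (-(τ - (τ - 2) / 2)) := by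
        rw [← Real.rpow_add hx0]
        congr 2
        ring

section LogKernel

lemma integrable_posLog_inv_norm_sq : Integrable fun z : Plane => posLog ‖z‖⁻¹ ^ 2 := by
  have hbound (t : ℝ) (ht : 0 < t) :
      ‖t * posLog t⁻¹ ^ 2‖ ≤ (Set.Ioc 0 1).indicator (fun _ => (4 : ℝ)) t := by
    by_cases h1 : t ≤ 1
    · have h := Real.abs_log_mul_self_lt (√t) (Real.sqrt_pos.2 ht) (Real.sqrt_le_one.2 h1)
      have hlog : posLog t⁻¹ = -Real.log t := by
        rw [Real.posLog_eq_log ((one_le_inv₀ ht).2 h1 |>.trans (le_abs_self _)), Real.log_inv]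
      have hsq : (Real.log t / 2 * √t) ^ 2 ≤ 1 := by
        rw [sq_le_one_iff_abs_le_one, ← Real.log_sqrt ht.le]
        exact h.le
      rw [mul_pow, Real.sq_sqrt ht.le] at hsq
      rw [Set.indicator_of_mem (Set.mem_Ioc.2 ⟨ht, h1⟩), hlog,
        neg_sq, Real.norm_of_nonneg (by positivity)]
      linarith
    · have hlog : posLog t⁻¹ = 0 :=
        (Real.posLog_eq_zero_iff _).2 (by
          rw [abs_of_pos (inv_pos.2 ht)]
          exact inv_le_one_of_one_le₀ (not_le.1 h1).le)
      simp [hlog, h1]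
  refine (integrable_fun_norm_addHaar volume (f := fun t => posLog t⁻¹ ^ 2)).2 ?_
  simp only [finrank_euclideanSpace, Fintype.card_fin, Nat.add_one_sub_one, pow_one, smul_eq_mul]
  have hmeas : Measurable fun t : ℝ => t * posLog t⁻¹ ^ 2 :=
    measurable_id.mul ((Real.continuous_posLog.measurable.comp measurable_inv).pow_const 2)
  have hmaj : Integrable ((Set.Ioc (0 : ℝ) 1).indicator fun _ => (4 : ℝ)) :=
    (integrable_indicator_iff measurableSet_Ioc).2 (integrableOn_const (by simp))
  exact hmaj.integrableOn.mono' hmeas.aestronglyMeasurable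
    ((ae_restrict_iff' measurableSet_Ioi).2 (.of_forall hbound))

lemma abs_log_norm_sub_sub_posLog_le {E : Type*} [SeminormedAddCommGroup E] (x y : E) :
    |Real.log ‖x - y‖ - posLog ‖x‖| ≤ Real.log 2 + posLog ‖y‖ + posLog ‖x - y‖⁻¹ := by
  have h1 := Real.posLog_norm_add_le x (-y)
  have h2 := Real.posLog_norm_add_le (x - y) y
  have h3 := Real.posLog_sub_posLog_inv (x := ‖x - y‖)
  have h4 := Real.posLog_nonneg (x := ‖x - y‖⁻¹)
  rw [← sub_eq_add_neg, norm_neg] at h1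
  rw [sub_add_cancel] at h2
  exact abs_le.2 ⟨by linarith, by linarith⟩

lemma abs_posLog_sub_log_max_le {ρ t : ℝ} (hρ : 0 < ρ) (ht : 0 ≤ t) :
    |posLog t - Real.log (max ρ t)| ≤ |Real.log ρ| := by
  rcases ht.eq_or_lt with rfl | ht
  · simp [max_eq_left hρ.le]
  · have hmax : Real.log (max ρ t) = max (Real.log ρ) (Real.log t) :=
      Real.strictMonoOn_log.monotoneOn.map_max hρ ht
    rw [Real.posLog_apply, hmax]
    exact (abs_max_sub_max_le_abs _ _ _).trans_eq (by rw [zero_sub, abs_neg])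

lemma log_gPlus {α ρ : ℝ} (hρ : 0 < ρ) (r : ℝ) :
    Real.log (gPlus α ρ r) = α * (Real.log (max ρ r) - Real.log ρ) := by
  have hmax : 0 < max ρ r := lt_max_of_lt_left hρ
  rw [gPlus_eq_max hρ, Real.log_mul (by positivity) (by positivity), Real.log_rpow hρ,
    Real.log_rpow hmax]
  ring

end LogKernel

section LogPotential

variable {B : Plane → ℝ} {ρ : ℝ}

namespace IsIntegrableField

lemma exists_integral_abs_le (hB : IsIntegrableField B) : ∃ M : ℝ, ∀ x : Plane,
    Integrable (fun y => B y * (Real.log ‖x - y‖ - posLog ‖x‖)) ∧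
      ∫ y, |B y * (Real.log ‖x - y‖ - posLog ‖x‖)| ≤ M := by
  set b : Plane → ℝ := fun y =>
    |B y| * Real.log 2 + |B y * posLog ‖y‖| + B y ^ 2 / 2 with hb
  set k : Plane → ℝ := fun z => posLog ‖z‖⁻¹ ^ 2 / 2 with hk
  have ib : Integrable b := ((hB.integrable.abs.mul_const _).add
    hB.integrable_mul_posLog.abs).add (hB.integrable_sq.div_const 2)
  have ik (x) : Integrable fun y => k (x - y) :=
    (integrable_posLog_inv_norm_sq.comp_sub_left x).div_const 2
  have hle (x y) : |B y * (Real.log ‖x - y‖ - posLog ‖x‖)| ≤ b y + k (x - y) := by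
    have h1 := mul_le_mul_of_nonneg_left (abs_log_norm_sub_sub_posLog_le x y) (abs_nonneg (B y))
    have h2 := two_mul_le_add_sq |B y| (posLog ‖x - y‖⁻¹)
    rw [sq_abs] at h2
    simp only [hb, hk, abs_mul, abs_of_nonneg (Real.posLog_nonneg (x := ‖y‖))]
    linarith
  refine ⟨(∫ y, b y) + ∫ z, k z, fun x => ?_⟩
  have hinteg : Integrable fun y => B y * (Real.log ‖x - y‖ - posLog ‖x‖) :=
    (ib.add (ik x)).mono' (hB.integrable.aestronglyMeasurable.mul (Measurable.sub (by fun_prop)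
      measurable_const).aestronglyMeasurable) (.of_forall (hle x))
  refine ⟨hinteg, (integral_mono hinteg.abs (ib.add (ik x)) (hle x)).trans_eq ?_⟩
  rw [← integral_sub_left_eq_self k volume x]
  exact integral_add ib (ik x)

lemma aestronglyMeasurable_kernel (hB : IsIntegrableField B) :
    AEStronglyMeasurable (fun p : Plane × Plane => B p.2 * Real.log ‖p.1 - p.2‖)
      (volume.prod volume) :=
  hB.integrable.aestronglyMeasurable.comp_snd.mul
    (by fun_prop : Measurable fun p : Plane × Plane =>
      Real.log ‖p.1 - p.2‖).aestronglyMeasurable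

lemma integrable_mul_log_norm_sub (hB : IsIntegrableField B) (x : Plane) :
    Integrable fun y => B y * Real.log ‖x - y‖ := by
  obtain ⟨M, hM⟩ := hB.exists_integral_abs_le
  refine ((hM x).1.add (hB.integrable.mul_const (posLog ‖x‖))).congr (.of_forall fun y => ?_)
  simp only [Pi.add_apply]
  ring

lemma exists_abs_logPotential_le (hB : IsIntegrableField B) :
    ∃ M : ℝ, ∀ x, |-logPotential B x - flux B * posLog ‖x‖| ≤ M := by
  obtain ⟨M, hM⟩ := hB.exists_integral_abs_le
  refine ⟨1 / (2 * π) * M, fun x => ?_⟩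
  have h : -logPotential B x - flux B * posLog ‖x‖ =
      1 / (2 * π) * ∫ y, B y * (Real.log ‖x - y‖ - posLog ‖x‖) := by
    simp_rw [mul_sub]
    rw [integral_sub (hB.integrable_mul_log_norm_sub x) (hB.integrable.mul_const _),
      integral_mul_const, logPotential, flux]
    ring
  rw [h, abs_mul, abs_of_pos (by positivity)]
  gcongr
  exact abs_integral_le_integral_abs.trans (hM x).2

lemma exists_abs_logPotential_sub_log_gPlus_le (hB : IsIntegrableField B) (hρ : 0 < ρ) :
    ∃ M : ℝ, ∀ x, |-logPotential B x - Real.log (gPlus (flux B) ρ ‖x‖)| ≤ M := by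
  obtain ⟨M, hM⟩ := hB.exists_abs_logPotential_le
  refine ⟨M + |flux B| * (|Real.log ρ| + |Real.log ρ|), fun x => ?_⟩
  calc |-logPotential B x - Real.log (gPlus (flux B) ρ ‖x‖)|
      = |(-logPotential B x - flux B * posLog ‖x‖) +
          flux B * ((posLog ‖x‖ - Real.log (max ρ ‖x‖)) + Real.log ρ)| := by
        rw [log_gPlus hρ]
        ring_nf
    _ ≤ |-logPotential B x - flux B * posLog ‖x‖| +
          |flux B| * (|posLog ‖x‖ - Real.log (max ρ ‖x‖)| + |Real.log ρ|) := by
        grw [abs_add_le, abs_mul, abs_add_le]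
    _ ≤ M + |flux B| * (|Real.log ρ| + |Real.log ρ|) := by
        have := abs_posLog_sub_log_max_le hρ (norm_nonneg x)
        gcongr
        exact hM x

end IsIntegrableField

lemma ratioPlus_eq_exp (hρ : 0 < ρ) (x : Plane) :
    ratioPlus B ρ x = Real.exp (-logPotential B x - Real.log (gPlus (flux B) ρ ‖x‖)) := by
  rw [ratioPlus, Real.exp_sub, Real.exp_log (gPlus_pos hρ)]

lemma kPlus_le_ratioPlus (hρ : 0 < ρ) (x : Plane) : kPlus B ρ ≤ ratioPlus B ρ x :=
  ciInf_le ⟨0, by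
    rintro _ ⟨x, rfl⟩
    simp only [ratioPlus_eq_exp hρ]
    positivity⟩ x

namespace IsIntegrableField

lemma kPlus_pos (hB : IsIntegrableField B) (hρ : 0 < ρ) : 0 < kPlus B ρ := by
  obtain ⟨M, hM⟩ := hB.exists_abs_logPotential_sub_log_gPlus_le hρ
  refine (Real.exp_pos (-M)).trans_le (le_ciInf fun x => ?_)
  rw [ratioPlus_eq_exp hρ]
  exact Real.exp_le_exp.2 (abs_le.1 (hM x)).1

lemma bddAbove_range_ratioPlus (hB : IsIntegrableField B) (hρ : 0 < ρ) :
    BddAbove (Set.range (ratioPlus B ρ)) := by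
  obtain ⟨M, hM⟩ := hB.exists_abs_logPotential_sub_log_gPlus_le hρ
  refine ⟨Real.exp M, Set.forall_mem_range.2 fun x => ?_⟩
  rw [ratioPlus_eq_exp hρ]
  exact Real.exp_le_exp.2 (abs_le.1 (hM x)).2

lemma ratioPlus_le_KPlus (hB : IsIntegrableField B) (hρ : 0 < ρ) (x : Plane) :
    ratioPlus B ρ x ≤ KPlus B ρ :=
  le_ciSup (hB.bddAbove_range_ratioPlus hρ) x

lemma locallyIntegrable_logPotential (hB : IsIntegrableField B) :
    LocallyIntegrable (logPotential B) := by
  obtain ⟨M, hM⟩ := hB.exists_abs_logPotential_le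
  have hc : Continuous fun x : Plane => M + |flux B| * posLog ‖x‖ := by
    have := continuous_posLog_norm
    fun_prop
  refine hc.locallyIntegrable.mono
    (hB.aestronglyMeasurable_kernel.integral_prod_right'.const_mul _) (.of_forall fun x => ?_)
  calc ‖logPotential B x‖
      = |(-logPotential B x - flux B * posLog ‖x‖) + flux B * posLog ‖x‖| := by
        rw [sub_add_cancel, abs_neg, Real.norm_eq_abs]
    _ ≤ M + |flux B| * posLog ‖x‖ := by
        grw [abs_add_le, hM x, abs_mul, abs_of_nonneg (Real.posLog_nonneg (x := ‖x‖))]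
    _ ≤ ‖M + |flux B| * posLog ‖x‖‖ := le_abs_self _

lemma integrable_prod_kernel_mul (hB : IsIntegrableField B) {f : Plane → ℝ} (hf : Continuous f)
    (hfc : HasCompactSupport f) :
    Integrable (fun p : Plane × Plane => B p.2 * Real.log ‖p.1 - p.2‖ * f p.1)
      (volume.prod volume) := by
  obtain ⟨M, hM⟩ := hB.exists_integral_abs_le
  have hbound (x) : ∫ y, |B y * Real.log ‖x - y‖| ≤ M + (∫ y, |B y|) * posLog ‖x‖ := by
    calc ∫ y, |B y * Real.log ‖x - y‖|
        ≤ ∫ y, (|B y * (Real.log ‖x - y‖ - posLog ‖x‖)| + |B y| * posLog ‖x‖) := by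
          refine integral_mono (hB.integrable_mul_log_norm_sub x).abs
            ((hM x).1.abs.add (hB.integrable.abs.mul_const _)) fun y => ?_
          dsimp only
          calc |B y * Real.log ‖x - y‖|
              = |B y * (Real.log ‖x - y‖ - posLog ‖x‖) + B y * posLog ‖x‖| := by ring_nf
            _ ≤ _ := by
              grw [abs_add_le, abs_mul (B y) (posLog _),
                abs_of_nonneg (Real.posLog_nonneg (x := ‖x‖))]
      _ ≤ M + (∫ y, |B y|) * posLog ‖x‖ := by
          rw [integral_add (hM x).1.abs (hB.integrable.abs.mul_const _), integral_mul_const]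
          gcongr
          exact (hM x).2
  have hmeas := hB.aestronglyMeasurable_kernel.mul hf.aestronglyMeasurable.comp_fst
  refine (integrable_prod_iff hmeas).2
    ⟨.of_forall fun x => (hB.integrable_mul_log_norm_sub x).mul_const (f x), ?_⟩
  have hc : Continuous fun x : Plane => (M + (∫ y, |B y|) * posLog ‖x‖) * |f x| := by
    have := continuous_posLog_norm
    fun_prop
  refine (hc.integrable_of_hasCompactSupport hfc.abs.mul_left).mono'
    hmeas.norm.integral_prod_right' (.of_forall fun x => ?_)
  rw [Real.norm_of_nonneg (integral_nonneg fun y => norm_nonneg _)]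
  simp only [Pi.mul_apply, norm_mul _ (f x), integral_mul_const, Real.norm_eq_abs]
  gcongr
  exact hbound x

lemma integral_logPotential_mul_laplacian (hB : IsIntegrableField B) {φ : Plane → ℝ}
    (hφ : ContDiff ℝ 2 φ) (hφc : HasCompactSupport φ) :
    ∫ x, logPotential B x * ∑ i, pderiv i (pderiv i φ) x = -∫ y, B y * φ y := by
  set D : Plane → ℝ := fun x => ∑ i, pderiv i (pderiv i φ) x
  calc ∫ x, logPotential B x * D x
      = -(1 / (2 * π)) * ∫ x, ∫ y, B y * Real.log ‖x - y‖ * D x := by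
        simp only [logPotential, integral_mul_const, mul_assoc (-(1 / (2 * π))), integral_const_mul]
    _ = -(1 / (2 * π)) * ∫ y, ∫ x, B y * Real.log ‖x - y‖ * D x := by
        rw [integral_integral_swap (hB.integrable_prod_kernel_mul (continuous_laplacian hφ)
          (hasCompactSupport_laplacian hφc))]
    _ = -(1 / (2 * π)) * ∫ y, B y * (2 * π * φ y) := by
        simp only [mul_assoc (B _), integral_const_mul (B _), D,
          integral_log_norm_sub_mul_laplacian hφ hφc]
    _ = -∫ y, B y * φ y := by
        simp only [mul_left_comm (B _), mul_assoc, integral_const_mul]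
        field_simp

end IsIntegrableField

end LogPotential

lemma two_le_infty : (2 : WithTop ℕ∞) ≤ (∞ : WithTop ℕ∞) := WithTop.coe_le_coe.2 le_top

section Mollification

variable {E : Type*} [NormedAddCommGroup E] [NormedSpace ℝ E] {ψ : Plane → ℝ} {f : Plane → E}

open scoped Convolution in
/-- The mollification `ψ ⋆ f` of `f` with the kernel `ψ`. -/
noncomputable def mollify (ψ : Plane → ℝ) (f : Plane → E) : Plane → E :=
  ψ ⋆[ContinuousLinearMap.lsmul ℝ ℝ, volume] f

lemma mollify_apply (ψ : Plane → ℝ) (f : Plane → E) (x : Plane) :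
    mollify ψ f x = ∫ t, ψ t • f (x - t) := rfl

lemma mollify_apply_swap (ψ : Plane → ℝ) (f : Plane → E) (x : Plane) :
    mollify ψ f x = ∫ t, ψ (x - t) • f t := convolution_lsmul_swap

lemma integrable_comp_sub_smul (hψ : Continuous ψ) (hψc : HasCompactSupport ψ)
    (hf : LocallyIntegrable f) (x : Plane) : Integrable fun t => ψ (x - t) • f t :=
  hf.integrable_smul_left_of_hasCompactSupport (hψ.comp (continuous_sub_left x))
    (hψc.comp_homeomorph (Homeomorph.subLeft x))

lemma contDiff_mollify {n : ℕ∞} (hψ : ContDiff ℝ n ψ) (hψc : HasCompactSupport ψ)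
    (hf : LocallyIntegrable f) : ContDiff ℝ n (mollify ψ f) :=
  hψc.contDiff_convolution_left _ hψ hf

lemma pderiv_mollify (hψ : ContDiff ℝ 1 ψ) (hψc : HasCompactSupport ψ)
    (hf : LocallyIntegrable f) (i : Fin 2) : pderiv i (mollify ψ f) = mollify (pderiv i ψ) f := by
  ext x
  have hderiv := hψc.hasFDerivAt_convolution_right (ContinuousLinearMap.lsmul ℝ ℝ).flip hf hψ x
  rw [convolution_flip] at hderiv
  have happly := pderiv_eq_of_hasFDerivAt hderiv i
  rwa [convolution_precompR_apply _ hf (hψc.fderiv (𝕜 := ℝ)) (hψ.continuous_fderiv one_ne_zero),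
    convolution_flip] at happly

lemma pderiv_comp_const_sub (hf : Differentiable ℝ f) (i : Fin 2) (x : Plane) :
    pderiv i (fun t => f (x - t)) = fun t => -pderiv i f (x - t) := by
  ext t
  have h := (hf (x - t)).hasFDerivAt.comp t ((hasFDerivAt_id t).const_sub x)
  refine (pderiv_eq_of_hasFDerivAt h i).trans ?_
  simp [pderiv]

lemma pderiv_pderiv_comp_const_sub (hf : ContDiff ℝ 2 f) (i : Fin 2) (x : Plane) :
    pderiv i (pderiv i fun t => f (x - t)) = fun t => pderiv i (pderiv i f) (x - t) := by
  have hneg (g : Plane → E) : pderiv i (fun t => -g t) = fun t => -pderiv i g t := by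
    ext t
    simp [pderiv, fderiv_fun_neg]
  rw [pderiv_comp_const_sub (hf.differentiable two_ne_zero), hneg, pderiv_comp_const_sub
    ((contDiff_pderiv (m := 1) hf (by norm_num) i).differentiable one_ne_zero)]
  simp only [neg_neg]

lemma pderiv_apply {a : Plane → Plane} (ha : Differentiable ℝ a) (i j : Fin 2) (x : Plane) :
    pderiv i (fun y => a y j) x = pderiv i a x j :=
  pderiv_eq_of_hasFDerivAt
    ((EuclideanSpace.proj j : Plane →L[ℝ] ℝ).hasFDerivAt.comp x (ha x).hasFDerivAt) i

lemma isTestFunction_comp_const_sub (hψ : IsTestFunction ψ) (x : Plane) :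
    IsTestFunction fun t => ψ (x - t) :=
  ⟨hψ.1.comp (contDiff_const.sub contDiff_id), hψ.2.comp_homeomorph (Homeomorph.subLeft x)⟩

lemma curl_mollify (hψ : IsTestFunction ψ) {A : Plane → Plane} {B : Plane → ℝ}
    (hA : LocallyIntegrable A) (hcurl : HasDistribCurl A B) (x : Plane) :
    pderiv 0 (mollify ψ A) x 1 - pderiv 1 (mollify ψ A) x 0 = ∫ t, B t * ψ (x - t) := by
  have hψ1 : ContDiff ℝ 1 ψ := hψ.1.of_le (mod_cast le_top)
  have hinteg (i) : Integrable fun t => pderiv i ψ (x - t) • A t :=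
    integrable_comp_sub_smul (continuous_pderiv hψ1 i) (hasCompactSupport_pderiv hψ.2 i) hA x
  have happly (i j) : pderiv i (mollify ψ A) x j = ∫ t, pderiv i ψ (x - t) * A t j := by
    rw [pderiv_mollify hψ1 hψ.2 hA, mollify_apply_swap,
      eval_integral_piLp fun j => (hinteg i).eval_piLp j]
    rfl
  rw [happly, happly, ← hcurl _ (isTestFunction_comp_const_sub hψ x)]
  refine (integral_sub ((hinteg 0).eval_piLp 1) ((hinteg 1).eval_piLp 0)).symm.trans ?_
  refine integral_congr_ae (.of_forall fun t => ?_)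
  simp only [partialDeriv_eq_pderiv, pderiv_comp_const_sub (hψ1.differentiable one_ne_zero),
    PiLp.smul_apply, smul_eq_mul]
  ring

lemma laplacian_mollify_logPotential (hψ : IsTestFunction ψ) {B : Plane → ℝ}
    (hB : IsIntegrableField B) (x : Plane) :
    ∑ i, pderiv i (pderiv i (mollify ψ (logPotential B))) x = -∫ t, B t * ψ (x - t) := by
  have hh := hB.locallyIntegrable_logPotential
  have hψ2 : ContDiff ℝ 2 ψ := hψ.1.of_le two_le_infty
  have hψ' (i) : ContDiff ℝ 1 (pderiv i ψ) := contDiff_pderiv hψ2 (by norm_num) i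
  have hψc (i) : HasCompactSupport (pderiv i ψ) := hasCompactSupport_pderiv hψ.2 i
  have ht := isTestFunction_comp_const_sub hψ x
  calc ∑ i, pderiv i (pderiv i (mollify ψ (logPotential B))) x
      = ∑ i, ∫ t, pderiv i (pderiv i ψ) (x - t) * logPotential B t := by
        simp only [pderiv_mollify (hψ2.of_le (by norm_num)) hψ.2 hh,
          pderiv_mollify (hψ' _) (hψc _) hh, mollify_apply_swap, smul_eq_mul]
    _ = ∫ t, logPotential B t * ∑ i, pderiv i (pderiv i fun t => ψ (x - t)) t := by
        simp only [pderiv_pderiv_comp_const_sub hψ2, mul_comm (logPotential B _),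
          Finset.sum_mul]
        exact (integral_finsetSum _ fun i _ => integrable_comp_sub_smul
          (continuous_pderiv (hψ' i) i) (hasCompactSupport_pderiv (hψc i) i) hh x).symm
    _ = -∫ t, B t * ψ (x - t) :=
        hB.integral_logPotential_mul_laplacian (ht.1.of_le two_le_infty) ht.2

end Mollification

section Gauge

lemma exists_pderiv_eq {F : Fin 2 → Plane → ℝ} (hF : ∀ i, ContDiff ℝ ∞ (F i))
    (hclosed : ∀ x, pderiv 0 (F 1) x = pderiv 1 (F 0) x) :
    ∃ χ : Plane → ℝ, ContDiff ℝ ∞ χ ∧ ∀ i x, pderiv i χ x = F i x := by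
  let coord (i : Fin 2) : Plane →L[ℝ] ℝ := EuclideanSpace.proj i
  have hcoord (i) (y : Plane) : coord i y = y i := rfl
  let G : Plane → Plane →L[ℝ] ℝ := fun x => ∑ i, F i x • coord i
  have hG : ContDiff ℝ ∞ G := ContDiff.sum fun i _ => (hF i).smul contDiff_const
  have hG' (x) : HasFDerivAt G (∑ i, (fderiv ℝ (F i) x).smulRight (coord i)) x :=
    HasFDerivAt.fun_sum fun i _ =>
      HasFDerivAt.smul_const (F := Plane →L[ℝ] ℝ)
        ((hF i).differentiable (by simp) x).hasFDerivAt (coord i)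
  obtain ⟨χ, hχ⟩ : ∃ χ : Plane → ℝ, ∀ x ∈ Set.univ, HasFDerivAt χ (G x) x :=
    convex_univ.exists_forall_hasFDerivAt_of_fderiv_symmetric isOpen_univ
      (hG.differentiable (by simp)).differentiableOn fun x _ y z => by
        simp only [(hG' x).fderiv, Fin.sum_univ_two, add_apply,
          ContinuousLinearMap.smulRight_apply, smul_apply, smul_eq_mul,
          fderiv_apply_eq_add_smul_pderiv, hcoord]
        linear_combination (y 0 * z 1 - z 0 * y 1) * hclosed x
  replace hχ (x) : HasFDerivAt χ (G x) x := hχ x (Set.mem_univ x)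
  refine ⟨χ, ?_, fun i x => ?_⟩
  · rw [show (∞ : WithTop ℕ∞) = (∞ : WithTop ℕ∞) + 1 from rfl, contDiff_succ_iff_fderiv,
      funext fun x => (hχ x).fderiv]
    exact ⟨fun x => (hχ x).differentiableAt, by simp, hG⟩
  · rw [pderiv_eq_of_hasFDerivAt (hχ x)]
    fin_cases i <;> simp [G, coord]

lemma exists_gauge {a : Plane → Plane} {η : Plane → ℝ} (ha : ContDiff ℝ ∞ a)
    (hη : ContDiff ℝ ∞ η)
    (hcurl : ∀ x, pderiv 0 a x 1 - pderiv 1 a x 0 = -∑ i, pderiv i (pderiv i η) x) :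
    ∃ χ : Plane → ℝ, ContDiff ℝ ∞ χ ∧
      ∀ x, a x 0 = pderiv 1 η x + pderiv 0 χ x ∧ a x 1 = -pderiv 0 η x + pderiv 1 χ x := by
  have ha' := contDiff_euclidean.1 ha
  have hη' (i) : ContDiff ℝ ∞ (pderiv i η) := contDiff_pderiv hη (by norm_num) i
  have hd {f : Plane → ℝ} (hf : ContDiff ℝ ∞ f) (x) : HasFDerivAt f (fderiv ℝ f x) x :=
    (hf.differentiable (by simp) x).hasFDerivAt
  obtain ⟨χ, hχ, hgrad⟩ := exists_pderiv_eq
    (F := ![fun x => a x 0 - pderiv 1 η x, fun x => a x 1 + pderiv 0 η x])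
    (Fin.forall_fin_two.2 ⟨(ha' 0).sub (hη' 1), (ha' 1).add (hη' 0)⟩) fun x => by
      have hF₁ : pderiv 0 (fun x => a x 1 + pderiv 0 η x) x =
          pderiv 0 a x 1 + pderiv 0 (pderiv 0 η) x := by
        rw [← pderiv_apply (ha.differentiable (by simp))]
        exact pderiv_eq_of_hasFDerivAt ((hd (ha' 1) x).add (hd (hη' 0) x)) 0
      have hF₀ : pderiv 1 (fun x => a x 0 - pderiv 1 η x) x =
          pderiv 1 a x 0 - pderiv 1 (pderiv 1 η) x := by
        rw [← pderiv_apply (ha.differentiable (by simp))]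
        exact pderiv_eq_of_hasFDerivAt ((hd (ha' 0) x).sub (hd (hη' 1) x)) 1
      have := hcurl x
      rw [Fin.sum_univ_two] at this
      simp only [Matrix.cons_val_zero, Matrix.cons_val_one, hF₁, hF₀]
      linarith
  refine ⟨χ, hχ, fun x => ⟨?_, ?_⟩⟩
  · simp [hgrad 0 x]
  · simp [hgrad 1 x]

/-- The first order operator `(i∂₁ + a₁) - i (i∂₂ + a₂)`, whose square modulus integrates to the
spin-up Pauli form; up to a factor `i` it is the Wirtinger operator `wirtingerDeriv` with magnetic
potential `a`. -/
noncomputable def magneticWirtinger (a : Plane → Plane) (u : Plane → ℂ) (x : Plane) : ℂ :=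
  (I * pderiv 0 u x + a x 0 * u x) - I * (I * pderiv 1 u x + a x 1 * u x)

variable {a : Plane → Plane} {u : Plane → ℂ}

lemma magneticWirtinger_eq_zero_of_notMem_tsupport {x : Plane} (h : x ∉ tsupport u) :
    magneticWirtinger a u x = 0 := by
  simp [magneticWirtinger, pderiv_eq_zero_of_notMem_tsupport h, image_eq_zero_of_notMem_tsupport h]

lemma continuous_magneticWirtinger (ha : Continuous a) (hu : ContDiff ℝ 1 u) :
    Continuous (magneticWirtinger a u) := by
  have hu0 := hu.continuous
  have hu' := continuous_pderiv hu
  unfold magneticWirtinger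
  fun_prop

lemma pderiv_exp_mul {w : Plane → ℂ} (hw : Differentiable ℝ w) (hu : Differentiable ℝ u)
    (i : Fin 2) (x : Plane) :
    pderiv i (fun y => Complex.exp (w y) * u y) x =
      Complex.exp (w x) * (pderiv i u x + pderiv i w x * u x) := by
  refine (pderiv_eq_of_hasFDerivAt ((hw x).hasFDerivAt.cexp.mul (hu x).hasFDerivAt) i).trans ?_
  simp only [add_apply, smul_apply, smul_eq_mul, pderiv]
  ring

/-- The multiplication with `exp (η - i χ)`, which removes a magnetic potential
`∇^⊥ η + ∇χ`. -/
noncomputable def gaugeTransform (η χ : Plane → ℝ) (u : Plane → ℂ) (x : Plane) : ℂ :=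
  Complex.exp (η x - I * χ x) * u x

lemma norm_gaugeTransform (η χ : Plane → ℝ) (u : Plane → ℂ) (x : Plane) :
    ‖gaugeTransform η χ u x‖ = Real.exp (η x) * ‖u x‖ := by
  simp [gaugeTransform, Complex.norm_exp]

lemma contDiff_gaugeTransform {n : WithTop ℕ∞} {η χ : Plane → ℝ} (hη : ContDiff ℝ n η)
    (hχ : ContDiff ℝ n χ) (hu : ContDiff ℝ n u) : ContDiff ℝ n (gaugeTransform η χ u) :=
  ((Complex.ofRealCLM.contDiff.comp hη).sub
    (contDiff_const.mul (Complex.ofRealCLM.contDiff.comp hχ))).cexp.mul hu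

lemma norm_wirtingerDeriv_gaugeTransform {η χ : Plane → ℝ} (hη : Differentiable ℝ η)
    (hχ : Differentiable ℝ χ) (hu : Differentiable ℝ u) {x : Plane}
    (ha₀ : a x 0 = pderiv 1 η x + pderiv 0 χ x) (ha₁ : a x 1 = -pderiv 0 η x + pderiv 1 χ x) :
    ‖wirtingerDeriv (gaugeTransform η χ u) x‖ = Real.exp (η x) * ‖magneticWirtinger a u x‖ := by
  have hw (x) : HasFDerivAt (fun y => (η y : ℂ) - I * χ y)
      (Complex.ofRealCLM.comp (fderiv ℝ η x) - I • Complex.ofRealCLM.comp (fderiv ℝ χ x)) x :=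
    (Complex.ofRealCLM.hasFDerivAt.comp x (hη x).hasFDerivAt).sub
      ((Complex.ofRealCLM.hasFDerivAt.comp x (hχ x).hasFDerivAt).const_mul I)
  have hpderiv (i) : pderiv i (gaugeTransform η χ u) x = Complex.exp (η x - I * χ x) *
      (pderiv i u x + (pderiv i η x - I * pderiv i χ x) * u x) := by
    unfold gaugeTransform
    rw [pderiv_exp_mul (fun x => (hw x).differentiableAt) hu]
    congr 3
    exact pderiv_eq_of_hasFDerivAt (hw x) i
  have hfactor : wirtingerDeriv (gaugeTransform η χ u) x =
      Complex.exp (η x - I * χ x) * (-I * magneticWirtinger a u x) := by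
    simp only [wirtingerDeriv, hpderiv, magneticWirtinger, ha₀, ha₁]
    push_cast
    linear_combination Complex.exp (η x - I * χ x) *
      (pderiv 0 u x - I * pderiv 1 u x + (pderiv 0 η x : ℝ) * u x) * Complex.I_sq
  simp [hfactor, Complex.norm_exp]

variable {η χ : Plane → ℝ} {α ρ k K : ℝ}

lemma integral_hardy_le_integral_gaugeTransform (hη : Continuous η) (hχ : Continuous χ)
    (hu : Continuous u) (huc : HasCompactSupport u) (hρ : 0 < ρ) (hK : 0 < K)
    (hKη : ∀ x, Real.exp (-η x) ≤ K * gPlus α ρ ‖x‖) :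
    K⁻¹ ^ 2 * ∫ x, ‖u x‖ ^ 2 / (ρ ^ 2 + ‖x‖ ^ 2) ≤
      ∫ x, gPlus α ρ ‖x‖ ^ 2 / (ρ ^ 2 + ‖x‖ ^ 2) * ‖gaugeTransform η χ u x‖ ^ 2 := by
  have hden (x : Plane) : ρ ^ 2 + ‖x‖ ^ 2 ≠ 0 := by positivity
  have hg := (continuous_hardy_weight (α := α) hρ).comp (continuous_norm (E := Plane))
  have hv := (contDiff_gaugeTransform (contDiff_zero.2 hη) (contDiff_zero.2 hχ)
    (contDiff_zero.2 hu)).continuous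
  rw [← integral_const_mul]
  refine integral_mono ?_ ?_ fun x => ?_
  · refine Continuous.integrable_of_hasCompactSupport (by fun_prop (disch := exact hden _))
      (HasCompactSupport.intro huc fun x hx => ?_)
    simp [image_eq_zero_of_notMem_tsupport hx]
  · refine (hg.mul (hv.norm.pow 2)).integrable_of_hasCompactSupport
      (HasCompactSupport.intro huc fun x hx => ?_)
    simp [gaugeTransform, image_eq_zero_of_notMem_tsupport hx]
  · have hle : K⁻¹ ≤ gPlus α ρ ‖x‖ * Real.exp (η x) := by
      rw [inv_le_iff_one_le_mul₀' hK, ← mul_assoc]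
      grw [← hKη x, ← Real.exp_add, neg_add_cancel, Real.exp_zero]
    calc K⁻¹ ^ 2 * (‖u x‖ ^ 2 / (ρ ^ 2 + ‖x‖ ^ 2))
        ≤ (gPlus α ρ ‖x‖ * Real.exp (η x)) ^ 2 * (‖u x‖ ^ 2 / (ρ ^ 2 + ‖x‖ ^ 2)) := by gcongr
      _ = gPlus α ρ ‖x‖ ^ 2 / (ρ ^ 2 + ‖x‖ ^ 2) * ‖gaugeTransform η χ u x‖ ^ 2 := by
        rw [norm_gaugeTransform]
        ring

lemma gPlus_sq_mul_norm_wirtingerDeriv_gaugeTransform_sq_le (hη : Differentiable ℝ η)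
    (hχ : Differentiable ℝ χ) (hu : Differentiable ℝ u) {x : Plane}
    (ha₀ : a x 0 = pderiv 1 η x + pderiv 0 χ x) (ha₁ : a x 1 = -pderiv 0 η x + pderiv 1 χ x)
    (hρ : 0 < ρ) (hk : 0 ≤ k) (hkη : k * gPlus α ρ ‖x‖ ≤ Real.exp (-η x)) :
    k ^ 2 * (gPlus α ρ ‖x‖ ^ 2 * ‖wirtingerDeriv (gaugeTransform η χ u) x‖ ^ 2) ≤
      ‖magneticWirtinger a u x‖ ^ 2 := by
  have hle : k * gPlus α ρ ‖x‖ * Real.exp (η x) ≤ 1 := by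
    grw [hkη, ← Real.exp_add, neg_add_cancel, Real.exp_zero]
  have hnonneg : 0 ≤ k * gPlus α ρ ‖x‖ * Real.exp (η x) := by
    have := gPlus_pos (α := α) hρ (r := ‖x‖)
    positivity
  calc k ^ 2 * (gPlus α ρ ‖x‖ ^ 2 * ‖wirtingerDeriv (gaugeTransform η χ u) x‖ ^ 2)
      = (k * gPlus α ρ ‖x‖ * Real.exp (η x)) ^ 2 * ‖magneticWirtinger a u x‖ ^ 2 := by
        rw [norm_wirtingerDeriv_gaugeTransform hη hχ hu ha₀ ha₁]
        ring
    _ ≤ ‖magneticWirtinger a u x‖ ^ 2 :=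
        mul_le_of_le_one_left (by positivity) (pow_le_one₀ hnonneg hle)

lemma hardy_gauge (hη : ContDiff ℝ 2 η) (hχ : ContDiff ℝ 2 χ) (ha : Continuous a)
    (hgauge : ∀ x, a x 0 = pderiv 1 η x + pderiv 0 χ x ∧ a x 1 = -pderiv 0 η x + pderiv 1 χ x)
    (hα : 0 ≤ α) (hρ : 0 < ρ) (hk : 0 ≤ k) (hK : 0 < K)
    (hkη : ∀ x, k * gPlus α ρ ‖x‖ ≤ Real.exp (-η x))
    (hKη : ∀ x, Real.exp (-η x) ≤ K * gPlus α ρ ‖x‖) (hu : ContDiff ℝ 2 u)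
    (huc : HasCompactSupport u) :
    distInt α ^ 2 * (k / K) ^ 2 * (∫ x, ‖u x‖ ^ 2 / (ρ ^ 2 + ‖x‖ ^ 2)) ≤
      ∫ x, ‖magneticWirtinger a u x‖ ^ 2 := by
  have hv : ContDiff ℝ 2 (gaugeTransform η χ u) := contDiff_gaugeTransform hη hχ hu
  have hvc : HasCompactSupport (gaugeTransform η χ u) := huc.mul_left
  calc distInt α ^ 2 * (k / K) ^ 2 * (∫ x, ‖u x‖ ^ 2 / (ρ ^ 2 + ‖x‖ ^ 2))
      = k ^ 2 * (distInt α ^ 2 * (K⁻¹ ^ 2 * ∫ x, ‖u x‖ ^ 2 / (ρ ^ 2 + ‖x‖ ^ 2))) := by ring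
    _ ≤ k ^ 2 * ∫ x, gPlus α ρ ‖x‖ ^ 2 * ‖wirtingerDeriv (gaugeTransform η χ u) x‖ ^ 2 := by
        grw [integral_hardy_le_integral_gaugeTransform hη.continuous hχ.continuous hu.continuous
          huc hρ hK hKη, hardy_smooth hv hvc hα hρ]
    _ ≤ ∫ x, ‖magneticWirtinger a u x‖ ^ 2 := by
        rw [← integral_const_mul]
        refine integral_mono ?_ ?_ fun x => ?_
        · have hg := (continuous_gPlus (α := α) hρ).comp (continuous_norm (E := Plane))
          have hD := continuous_wirtingerDeriv (hv.of_le one_le_two)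
          refine (Continuous.integrable_of_hasCompactSupport ((hg.pow 2).mul (hD.norm.pow 2))
            (HasCompactSupport.intro hvc fun x hx => ?_)).const_mul _
          simp [wirtingerDeriv_eq_zero_of_notMem_tsupport hx]
        · have hD := continuous_magneticWirtinger ha (hu.of_le one_le_two)
          refine (hD.norm.pow 2).integrable_of_hasCompactSupport
            (HasCompactSupport.intro huc fun x hx => ?_)
          simp [magneticWirtinger_eq_zero_of_notMem_tsupport hx]
        · exact gPlus_sq_mul_norm_wirtingerDeriv_gaugeTransform_sq_le
            (hη.differentiable two_ne_zero) (hχ.differentiable two_ne_zero)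
            (hu.differentiable two_ne_zero) (hgauge x).1 (hgauge x).2 hρ hk (hkη x)

end Gauge

section Mollifier

/-- A sequence of bump functions that concentrates at the origin. -/
noncomputable def bump (n : ℕ) : ContDiffBump (0 : Plane) where
  rIn := 1 / ((n : ℝ) + 1) / 2
  rOut := 1 / ((n : ℝ) + 1)
  rIn_pos := by positivity
  rIn_lt_rOut := half_lt_self (by positivity)

/-- The standard mollifiers: smooth probability densities supported in the discs of radius
`1 / (n + 1)`. -/
noncomputable def mollifier (n : ℕ) : Plane → ℝ := (bump n).normed volume

lemma isTestFunction_mollifier (n : ℕ) : IsTestFunction (mollifier n) :=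
  ⟨(bump n).contDiff_normed, (bump n).hasCompactSupport_normed⟩

lemma mollifier_nonneg (n : ℕ) (x : Plane) : 0 ≤ mollifier n x := (bump n).nonneg_normed x

lemma integral_mollifier (n : ℕ) : ∫ x, mollifier n x = 1 := (bump n).integral_normed

lemma integrable_mollifier (n : ℕ) : Integrable (mollifier n) := (bump n).integrable_normed

lemma mollifier_eq_zero_of_le_norm (n : ℕ) {x : Plane} (hx : 1 / ((n : ℝ) + 1) ≤ ‖x‖) :
    mollifier n x = 0 := by
  rw [← Function.notMem_support, mollifier, (bump n).support_normed_eq]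
  simpa [bump] using hx

variable {E : Type*} [NormedAddCommGroup E] [NormedSpace ℝ E] {f : Plane → E}

lemma contDiff_mollify_mollifier (n : ℕ) (hf : LocallyIntegrable f) :
    ContDiff ℝ ∞ (mollify (mollifier n) f) :=
  contDiff_mollify (isTestFunction_mollifier n).1 (isTestFunction_mollifier n).2 hf

lemma integrable_mollifier_smul_comp_sub (n : ℕ) (hf : LocallyIntegrable f) (x : Plane) :
    Integrable fun t => mollifier n t • f (x - t) :=
  (isTestFunction_mollifier n).2.convolutionExists_left (ContinuousLinearMap.lsmul ℝ ℝ)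
    (isTestFunction_mollifier n).1.continuous hf x

lemma tendsto_mollify_mollifier [CompleteSpace E] (hf : LocallyIntegrable f) :
    ∀ᵐ x, Tendsto (fun n => mollify (mollifier n) f x) atTop (𝓝 (f x)) := by
  refine ContDiffBump.ae_convolution_tendsto_right_of_locallyIntegrable (φ := bump) (K := 2)
    tendsto_one_div_add_atTop_nhds_zero_nat (.of_forall fun n => ?_) hf
  simp only [bump]
  linarith

lemma norm_mollify_mollifier_le (n : ℕ) {C : ℝ} (hC : ∀ᵐ x, ‖f x‖ ≤ C) (x : Plane) :
    ‖mollify (mollifier n) f x‖ ≤ C := by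
  have hmass : ∫ t, mollifier n (x - t) * C = C := by
    rw [integral_mul_const, integral_sub_left_eq_self (mollifier n) volume x, integral_mollifier,
      one_mul]
  rw [mollify_apply_swap, ← hmass]
  refine norm_integral_le_of_norm_le (((integrable_mollifier n).comp_sub_left x).mul_const C) ?_
  filter_upwards [hC] with t ht
  rw [norm_smul, Real.norm_of_nonneg (mollifier_nonneg n _)]
  exact mul_le_mul_of_nonneg_left ht (mollifier_nonneg n _)

lemma mollify_mollifier_mem_Icc (n : ℕ) {f : Plane → ℝ} (hf : LocallyIntegrable f) {a b : ℝ}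
    {x : Plane} (hab : ∀ t, ‖t‖ ≤ 1 / ((n : ℝ) + 1) → f (x - t) ∈ Set.Icc a b) :
    mollify (mollifier n) f x ∈ Set.Icc a b := by
  have hmass (c : ℝ) : ∫ t, mollifier n t * c = c := by
    rw [integral_mul_const, integral_mollifier, one_mul]
  have hinteg (c : ℝ) : Integrable fun t => mollifier n t * c :=
    (integrable_mollifier n).mul_const c
  have hf' := integrable_mollifier_smul_comp_sub n hf x
  have hpointwise (t) : mollifier n t * f (x - t) ∈
      Set.Icc (mollifier n t * a) (mollifier n t * b) := by
    rcases le_total ‖t‖ (1 / ((n : ℝ) + 1)) with ht | ht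
    · exact ⟨mul_le_mul_of_nonneg_left (hab t ht).1 (mollifier_nonneg n t),
        mul_le_mul_of_nonneg_left (hab t ht).2 (mollifier_nonneg n t)⟩
    · simp [mollifier_eq_zero_of_le_norm n ht]
  rw [← hmass a, ← hmass b]
  exact ⟨integral_mono (hinteg a) hf' fun t => (hpointwise t).1,
    integral_mono hf' (hinteg b) fun t => (hpointwise t).2⟩

end Mollifier

section RoughPotential

lemma abs_log_gPlus_sub_log_gPlus_le {α ρ : ℝ} (hα : 0 ≤ α) (hρ : 0 < ρ) (r s : ℝ) :
    |Real.log (gPlus α ρ r) - Real.log (gPlus α ρ s)| ≤ α / ρ * |r - s| := by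
  have hlog (r s) : Real.log (max ρ r) - Real.log (max ρ s) ≤ |r - s| / ρ := by
    have hr : 0 < max ρ r := lt_max_of_lt_left hρ
    have hs : 0 < max ρ s := lt_max_of_lt_left hρ
    calc Real.log (max ρ r) - Real.log (max ρ s) = Real.log (max ρ r / max ρ s) :=
          (Real.log_div hr.ne' hs.ne').symm
      _ ≤ (max ρ r - max ρ s) / max ρ s := by
          rw [← div_sub_one hs.ne']
          exact Real.log_le_sub_one_of_pos (by positivity)
      _ ≤ |r - s| / ρ := by
          have hmax : max ρ r - max ρ s ≤ |r - s| := by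
            simpa using (le_abs_self _).trans (abs_max_sub_max_le_max ρ r ρ s)
          gcongr
          exact le_max_left _ _
  have habs : |Real.log (max ρ r) - Real.log (max ρ s)| ≤ |r - s| / ρ :=
    abs_sub_le_iff.2 ⟨hlog r s, abs_sub_comm r s ▸ hlog s r⟩
  calc |Real.log (gPlus α ρ r) - Real.log (gPlus α ρ s)|
      = α * |Real.log (max ρ r) - Real.log (max ρ s)| := by
        rw [log_gPlus hρ, log_gPlus hρ, ← mul_sub, sub_sub_sub_cancel_right, abs_mul,
          abs_of_nonneg hα]
    _ ≤ α / ρ * |r - s| := by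
        grw [habs]
        exact (mul_comm_div _ _ _).ge

variable {B : Plane → ℝ} {A : Plane → Plane} {ρ : ℝ} {u : Plane → ℂ}

lemma IsIntegrableField.logPotential_sub_mem_Icc (hB : IsIntegrableField B) (hflux : 0 ≤ flux B)
    (hρ : 0 < ρ) {δ : ℝ} {x t : Plane} (ht : ‖t‖ ≤ δ) :
    logPotential B (x - t) ∈
      Set.Icc (-Real.log (KPlus B ρ) - Real.log (gPlus (flux B) ρ ‖x‖) - flux B / ρ * δ)
        (-Real.log (kPlus B ρ) - Real.log (gPlus (flux B) ρ ‖x‖) + flux B / ρ * δ) := by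
  have hlog : Real.log (ratioPlus B ρ (x - t)) =
      -logPotential B (x - t) - Real.log (gPlus (flux B) ρ ‖x - t‖) := by
    rw [ratioPlus_eq_exp hρ, Real.log_exp]
  have hnorm : |‖x - t‖ - ‖x‖| ≤ δ := by
    simpa using (abs_norm_sub_norm_le (x - t) x).trans (by simpa using ht)
  have hg := abs_le.1 ((abs_log_gPlus_sub_log_gPlus_le hflux hρ ‖x - t‖ ‖x‖).trans
    (mul_le_mul_of_nonneg_left hnorm (by positivity)))
  have hk := Real.log_le_log (hB.kPlus_pos hρ) (kPlus_le_ratioPlus hρ (x - t))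
  have hK := Real.log_le_log ((hB.kPlus_pos hρ).trans_le (kPlus_le_ratioPlus hρ (x - t)))
    (hB.ratioPlus_le_KPlus hρ (x - t))
  constructor <;> linarith [hg.1, hg.2]

lemma IsIntegrableField.KPlus_pos (hB : IsIntegrableField B) (hρ : 0 < ρ) : 0 < KPlus B ρ :=
  (hB.kPlus_pos hρ).trans_le ((kPlus_le_ratioPlus hρ 0).trans (hB.ratioPlus_le_KPlus hρ 0))

lemma IsIntegrableField.exp_neg_mollify_mem_Icc (hB : IsIntegrableField B) (hflux : 0 ≤ flux B)
    (hρ : 0 < ρ) (n : ℕ) (x : Plane) :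
    Real.exp (-mollify (mollifier n) (logPotential B) x) ∈
      Set.Icc (kPlus B ρ * Real.exp (-(flux B / ρ * (1 / (n + 1)))) * gPlus (flux B) ρ ‖x‖)
        (KPlus B ρ * Real.exp (flux B / ρ * (1 / (n + 1))) * gPlus (flux B) ρ ‖x‖) := by
  have hmem := mollify_mollifier_mem_Icc n hB.locallyIntegrable_logPotential (x := x) fun t ht =>
    hB.logPotential_sub_mem_Icc hflux hρ ht
  have hexp {c : ℝ} (hc : 0 < c) (s : ℝ) : c * Real.exp s * gPlus (flux B) ρ ‖x‖ =
      Real.exp (Real.log c + s + Real.log (gPlus (flux B) ρ ‖x‖)) := by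
    rw [Real.exp_add, Real.exp_add, Real.exp_log hc, Real.exp_log (gPlus_pos hρ)]
  rw [hexp (hB.kPlus_pos hρ), hexp (hB.KPlus_pos hρ), Set.mem_Icc, Real.exp_le_exp,
    Real.exp_le_exp]
  constructor <;> linarith [hmem.1, hmem.2]

lemma ae_norm_le_toReal_eLpNorm (hA : MemLp A ∞) : ∀ᵐ x, ‖A x‖ ≤ (eLpNorm A ∞ volume).toReal := by
  filter_upwards [ae_le_eLpNormEssSup (f := A) (μ := volume)] with x hx
  rwa [← ENNReal.ofReal_le_iff_le_toReal hA.2.ne, ofReal_norm, eLpNorm_exponent_top]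

lemma norm_magneticWirtinger_le (a : Plane → Plane) (u : Plane → ℂ) (x : Plane) :
    ‖magneticWirtinger a u x‖ ≤ ‖pderiv 0 u x‖ + ‖pderiv 1 u x‖ + 2 * ‖a x‖ * ‖u x‖ := by
  have hcomponent (j) : ‖I * pderiv j u x + a x j * u x‖ ≤ ‖pderiv j u x‖ + ‖a x‖ * ‖u x‖ := by
    grw [norm_add_le, norm_mul, norm_mul, Complex.norm_I, one_mul, Complex.norm_real,
      PiLp.norm_apply_le (a x) j]
  grw [magneticWirtinger, norm_sub_le, norm_mul, Complex.norm_I, one_mul, hcomponent, hcomponent]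
  linarith

lemma tendsto_integral_magneticWirtinger_mollify (hA : MemLp A ∞) (hu : ContDiff ℝ 1 u)
    (huc : HasCompactSupport u) :
    Tendsto (fun n => ∫ x, ‖magneticWirtinger (mollify (mollifier n) A) u x‖ ^ 2) atTop
      (𝓝 (∫ x, ‖magneticWirtinger A u x‖ ^ 2)) := by
  have hA' : LocallyIntegrable A := hA.locallyIntegrable le_top
  have hu0 := hu.continuous
  have hu' := continuous_pderiv hu
  set C := (eLpNorm A ∞ volume).toReal
  refine tendsto_integral_of_dominated_convergence
    (fun x => (‖pderiv 0 u x‖ + ‖pderiv 1 u x‖ + 2 * C * ‖u x‖) ^ 2) (fun n => ?_) ?_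
    (fun n => .of_forall fun x => ?_) ?_
  · exact ((continuous_magneticWirtinger (contDiff_mollify_mollifier n hA').continuous
      hu).norm.pow 2).aestronglyMeasurable
  · refine Continuous.integrable_of_hasCompactSupport (by fun_prop)
      (HasCompactSupport.intro huc fun x hx => ?_)
    simp [pderiv_eq_zero_of_notMem_tsupport hx, image_eq_zero_of_notMem_tsupport hx]
  · rw [norm_pow, norm_norm]
    grw [norm_magneticWirtinger_le,
      norm_mollify_mollifier_le n (ae_norm_le_toReal_eLpNorm hA) x]
  · filter_upwards [tendsto_mollify_mollifier hA'] with x hx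
    have hcomponent (j : Fin 2) :
        Tendsto (fun n => (mollify (mollifier n) A x j : ℂ)) atTop (𝓝 (A x j : ℂ)) :=
      ((Complex.continuous_ofReal.comp
        (EuclideanSpace.proj j : Plane →L[ℝ] ℝ).continuous).tendsto _).comp hx
    exact ((((hcomponent 0).mul_const _).const_add _).sub
      ((((hcomponent 1).mul_const _).const_add _).const_mul _)).norm.pow 2

lemma hardy_magneticWirtinger (hB : IsIntegrableField B) (hflux : 0 ≤ flux B) (hA : MemLp A ∞)
    (hcurl : HasDistribCurl A B) (hρ : 0 < ρ) (hu : ContDiff ℝ 2 u) (huc : HasCompactSupport u) :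
    distInt (flux B) ^ 2 * betaPlus B ρ * (∫ x, ‖u x‖ ^ 2 / (ρ ^ 2 + ‖x‖ ^ 2)) ≤
      ∫ x, ‖magneticWirtinger A u x‖ ^ 2 := by
  have hA' : LocallyIntegrable A := hA.locallyIntegrable le_top
  have hk := hB.kPlus_pos hρ
  have hK := hB.KPlus_pos hρ
  set ε : ℕ → ℝ := fun n => flux B / ρ * (1 / (n + 1))
  have hε : Tendsto ε atTop (𝓝 0) := by
    simpa only [mul_zero] using
      (tendsto_one_div_add_atTop_nhds_zero_nat (𝕜 := ℝ)).const_mul (flux B / ρ)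
  have hmollified (n : ℕ) : distInt (flux B) ^ 2 *
      (kPlus B ρ * Real.exp (-ε n) / (KPlus B ρ * Real.exp (ε n))) ^ 2 *
      (∫ x, ‖u x‖ ^ 2 / (ρ ^ 2 + ‖x‖ ^ 2)) ≤
      ∫ x, ‖magneticWirtinger (mollify (mollifier n) A) u x‖ ^ 2 := by
    have ha := contDiff_mollify_mollifier n hA'
    have hη := contDiff_mollify_mollifier n hB.locallyIntegrable_logPotential
    obtain ⟨χ, hχ, hgauge⟩ := exists_gauge ha hη fun x => by
      rw [curl_mollify (isTestFunction_mollifier n) hA' hcurl,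
        laplacian_mollify_logPotential (isTestFunction_mollifier n) hB, neg_neg]
    exact hardy_gauge (hη.of_le two_le_infty) (hχ.of_le two_le_infty) ha.continuous hgauge hflux
      hρ (by positivity) (by positivity) (fun x => (hB.exp_neg_mollify_mem_Icc hflux hρ n x).1)
      (fun x => (hB.exp_neg_mollify_mem_Icc hflux hρ n x).2) hu huc
  have hconst : Continuous fun ε : ℝ => distInt (flux B) ^ 2 *
      (kPlus B ρ * Real.exp (-ε) / (KPlus B ρ * Real.exp ε)) ^ 2 *
      (∫ x, ‖u x‖ ^ 2 / (ρ ^ 2 + ‖x‖ ^ 2)) := by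
    fun_prop (disch := intros; positivity)
  exact le_of_tendsto_of_tendsto' ((hconst.tendsto' 0 _ (by simp [betaPlus])).comp hε)
    (tendsto_integral_magneticWirtinger_mollify hA (hu.of_le one_le_two) huc) hmollified

end RoughPotential

section PointwiseDerivatives

lemma pderiv_pderiv_comm {f : Plane → ℝ} (hf : ContDiff ℝ 2 f) (i j : Fin 2) :
    pderiv i (pderiv j f) = pderiv j (pderiv i f) := by
  ext x
  have hD : Differentiable ℝ (fderiv ℝ f) :=
    (hf.fderiv_right (m := 1) (by norm_num)).differentiable one_ne_zero
  have hpderiv (i j) : pderiv i (pderiv j f) x = fderiv ℝ (fderiv ℝ f) x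
      (EuclideanSpace.single i 1) (EuclideanSpace.single j 1) :=
    pderiv_eq_of_hasFDerivAt ((ContinuousLinearMap.apply ℝ ℝ
      (EuclideanSpace.single j (1 : ℝ))).hasFDerivAt.comp x (hD x).hasFDerivAt) i
  rw [hpderiv, hpderiv]
  exact (hf.contDiffAt.isSymmSndFDerivAt (by simp)).eq _ _

lemma pderiv_clm_comp {E F : Type*} [NormedAddCommGroup E] [NormedSpace ℝ E]
    [NormedAddCommGroup F] [NormedSpace ℝ F] (L : E →L[ℝ] F) {u : Plane → E}
    (hu : Differentiable ℝ u) (i : Fin 2) (x : Plane) :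
    pderiv i (fun x => L (u x)) x = L (pderiv i u x) :=
  pderiv_eq_of_hasFDerivAt (L.hasFDerivAt.comp x (hu x).hasFDerivAt) i

lemma pderiv_norm_sq {E : Type*} [NormedAddCommGroup E] [InnerProductSpace ℝ E] {u : Plane → E}
    (hu : Differentiable ℝ u) (i : Fin 2) (x : Plane) :
    pderiv i (fun x => ‖u x‖ ^ 2) x = 2 * inner ℝ (u x) (pderiv i u x) := by
  rw [pderiv_eq_of_hasFDerivAt (hu x).hasFDerivAt.norm_sq]
  simp [pderiv]

lemma norm_fderiv_le {E : Type*} [NormedAddCommGroup E] [NormedSpace ℝ E] (f : Plane → E)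
    (x : Plane) : ‖fderiv ℝ f x‖ ≤ ‖pderiv 0 f x‖ + ‖pderiv 1 f x‖ := by
  refine ContinuousLinearMap.opNorm_le_bound _ (by positivity) fun y => ?_
  grw [fderiv_apply_eq_add_smul_pderiv, norm_add_le, norm_smul, norm_smul, PiLp.norm_apply_le y 0,
    PiLp.norm_apply_le y 1]
  linarith

end PointwiseDerivatives

section FormIdentity

lemma integral_jacobian_eq_zero {p q : Plane → ℝ} (hp : ContDiff ℝ 2 p) (hq : ContDiff ℝ 1 q)
    (hqc : HasCompactSupport q) :
    Integrable (fun x => pderiv 0 p x * pderiv 1 q x - pderiv 1 p x * pderiv 0 q x) ∧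
      ∫ x, (pderiv 0 p x * pderiv 1 q x - pderiv 1 p x * pderiv 0 q x) = 0 := by
  have hp' (i) : ContDiff ℝ 1 (pderiv i p) := contDiff_pderiv hp (by norm_num) i
  have hinteg (i j) : Integrable fun x => pderiv i p x * pderiv j q x :=
    ((hp' i).continuous.mul (continuous_pderiv hq j)).integrable_of_hasCompactSupport
      (hasCompactSupport_pderiv hqc j).mul_left
  refine ⟨(hinteg 0 1).sub (hinteg 1 0), ?_⟩
  rw [integral_sub (hinteg 0 1) (hinteg 1 0), integral_mul_pderiv (hp' 0) hq hqc,
    integral_mul_pderiv (hp' 1) hq hqc, pderiv_pderiv_comm hp 1 0, sub_self]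

lemma isTestFunction_norm_sq {u : Plane → ℂ} (hu : ContDiff ℝ ∞ u) (huc : HasCompactSupport u) :
    IsTestFunction fun x => ‖u x‖ ^ 2 :=
  ⟨hu.norm_sq ℝ, huc.comp_left (g := fun z => ‖z‖ ^ 2) (by simp)⟩

variable {A : Plane → Plane} {B : Plane → ℝ} {u : Plane → ℂ}

lemma memLp_magnetic (hA : MemLp A ∞) {v : Plane → ℂ} (hu : MemLp u 2) (hv : MemLp v 2)
    (j : Fin 2) : MemLp (fun x => I * v x + A x j * u x) 2 := by
  have hAj : MemLp (fun x => (A x j : ℂ)) ∞ :=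
    (Complex.ofRealCLM ∘L (EuclideanSpace.proj j : Plane →L[ℝ] ℝ)).comp_memLp' hA
  exact (hv.const_mul I).add (hu.mul hAj)

lemma memLp_pderiv {E : Type*} [NormedAddCommGroup E] [NormedSpace ℝ E] {u : Plane → E}
    (hu : ContDiff ℝ 1 u) (huc : HasCompactSupport u) (i : Fin 2) (p : ℝ≥0∞) :
    MemLp (pderiv i u) p :=
  (continuous_pderiv hu i).memLp_of_hasCompactSupport (hasCompactSupport_pderiv huc i)

lemma norm_magneticWirtinger_sq (hu : Differentiable ℝ u) (x : Plane) :
    ‖magneticWirtinger A u x‖ ^ 2 =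
      ∑ j, ‖I * pderiv j u x + A x j * u x‖ ^ 2 +
        (A x 0 * pderiv 1 (fun x => ‖u x‖ ^ 2) x - A x 1 * pderiv 0 (fun x => ‖u x‖ ^ 2) x) +
        2 * (pderiv 0 (fun x => (u x).re) x * pderiv 1 (fun x => (u x).im) x -
          pderiv 1 (fun x => (u x).re) x * pderiv 0 (fun x => (u x).im) x) := by
  have hre (i) : pderiv i (fun x => (u x).re) x = (pderiv i u x).re :=
    pderiv_clm_comp Complex.reCLM hu i x
  have him (i) : pderiv i (fun x => (u x).im) x = (pderiv i u x).im :=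
    pderiv_clm_comp Complex.imCLM hu i x
  simp only [hre, him, pderiv_norm_sq hu, Fin.sum_univ_two, magneticWirtinger, Complex.inner]
  simp only [← Complex.normSq_eq_norm_sq, Complex.normSq_apply]
  simp only [Complex.sub_re, Complex.add_re, Complex.mul_re, Complex.I_re, zero_mul, Complex.I_im,
    one_mul, zero_sub, Complex.ofReal_re, Complex.ofReal_im, sub_zero, Complex.add_im,
    Complex.mul_im, zero_add, add_zero, neg_add_rev, Complex.sub_im, Complex.conj_re,
    Complex.conj_im, mul_neg, sub_neg_eq_add]
  ring

lemma pauliPlusForm_eq_integral_magneticWirtinger (hB : LocallyIntegrable B) (hA : MemLp A ∞)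
    (hcurl : HasDistribCurl A B) (hu : ContDiff ℝ ∞ u) (huc : HasCompactSupport u) :
    pauliPlusForm A B u (pderiv · u) = ∫ x, ‖magneticWirtinger A u x‖ ^ 2 := by
  have hu1 : ContDiff ℝ 1 u := hu.of_le (by exact_mod_cast le_top)
  have hsq := isTestFunction_norm_sq hu huc
  have hsq1 : ContDiff ℝ 1 fun x => ‖u x‖ ^ 2 := hu1.norm_sq ℝ
  obtain ⟨hjac, hjac0⟩ := integral_jacobian_eq_zero (p := fun x => (u x).re)
    (q := fun x => (u x).im) (Complex.reCLM.contDiff.comp (hu.of_le two_le_infty))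
    (Complex.imCLM.contDiff.comp hu1) (huc.comp_left (g := Complex.im) rfl)
  have hmagnetic : Integrable fun x => ∑ j, ‖I * pderiv j u x + A x j * u x‖ ^ 2 :=
    integrable_finsetSum _ fun j _ => (memLp_magnetic hA
      (hu.continuous.memLp_of_hasCompactSupport huc)
      (memLp_pderiv hu1 huc j 2) j).integrable_norm_pow two_ne_zero
  have hBu : Integrable fun x => B x * ‖u x‖ ^ 2 :=
    hB.integrable_smul_right_of_hasCompactSupport hsq.1.continuous hsq.2
  have hAu (i j) : Integrable fun x => A x j * pderiv i (fun x => ‖u x‖ ^ 2) x :=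
    ((EuclideanSpace.proj j : Plane →L[ℝ] ℝ).comp_memLp' hA |>.locallyIntegrable
      le_top).integrable_smul_right_of_hasCompactSupport (continuous_pderiv hsq1 i)
      (hasCompactSupport_pderiv hsq.2 i)
  have hAu' : Integrable fun x => A x 0 * pderiv 1 (fun x => ‖u x‖ ^ 2) x -
      A x 1 * pderiv 0 (fun x => ‖u x‖ ^ 2) x := (hAu 1 0).sub (hAu 0 1)
  have hmagneticAu : Integrable fun x => ∑ j, ‖I * pderiv j u x + A x j * u x‖ ^ 2 +
      (A x 0 * pderiv 1 (fun x => ‖u x‖ ^ 2) x - A x 1 * pderiv 0 (fun x => ‖u x‖ ^ 2) x) :=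
    hmagnetic.add hAu'
  simp only [norm_magneticWirtinger_sq (hu1.differentiable one_ne_zero)]
  rw [integral_add hmagneticAu (hjac.const_mul 2), integral_const_mul, hjac0, mul_zero, add_zero,
    integral_add hmagnetic hAu']
  exact (integral_add hmagnetic hBu).trans (congrArg _ (hcurl _ hsq).symm)

end FormIdentity

section Ladyzhenskaya

variable {E : Type*} [NormedAddCommGroup E] [InnerProductSpace ℝ E] {v : Plane → E}

/-- The constant in Ladyzhenskaya's inequality `‖v‖₄² ≤ C ‖v‖₂ (‖∂₁v‖₂ + ‖∂₂v‖₂)`, which comes from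
the embedding of `W^{1,1}(ℝ²)` into `L²(ℝ²)`. -/
noncomputable def ladyzhenskayaConst : ℝ≥0 :=
  2 * eLpNormLESNormFDerivOneConst (volume : Measure Plane) 2

lemma eLpNorm_four_sq_le (hv : ContDiff ℝ 1 v) (hvc : HasCompactSupport v) :
    eLpNorm v 4 volume ^ 2 ≤
      ladyzhenskayaConst * (eLpNorm v 2 volume * ∑ i, eLpNorm (pderiv i v) 2 volume) := by
  set φ : Plane → ℝ := fun x => ‖v x‖ ^ 2
  have hφ : ContDiff ℝ 1 φ := hv.norm_sq ℝ
  have hconj : NNReal.HolderConjugate (Module.finrank ℝ Plane) 2 := by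
    rw [finrank_euclideanSpace, Fintype.card_fin, NNReal.holderConjugate_iff]
    norm_num
  have hpderiv (i) : eLpNorm (pderiv i φ) 1 volume ≤
      2 * eLpNorm v 2 volume * eLpNorm (pderiv i v) 2 volume := by
    rw [funext (pderiv_norm_sq (hv.differentiable one_ne_zero) i)]
    refine eLpNorm_le_eLpNorm_mul_eLpNorm'_of_norm hv.continuous.aestronglyMeasurable
      (continuous_pderiv hv i).aestronglyMeasurable (fun a b => 2 * inner ℝ a b) 2
      (.of_forall fun x => ?_)
    rw [norm_mul, Real.norm_ofNat, mul_assoc]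
    exact mul_le_mul_of_nonneg_left (norm_inner_le_norm _ _) two_pos.le
  calc eLpNorm v 4 volume ^ 2 = eLpNorm φ 2 volume := by
        have := eLpNorm_norm_rpow (p := 2) (μ := volume) v two_pos
        norm_num at this
        exact this.symm
    _ ≤ eLpNormLESNormFDerivOneConst (volume : Measure Plane) 2 *
          eLpNorm (fderiv ℝ φ) 1 volume :=
        eLpNorm_le_eLpNorm_fderiv_one volume hφ
          (hvc.comp_left (g := fun z => ‖z‖ ^ 2) (by simp)) hconj
    _ ≤ eLpNormLESNormFDerivOneConst (volume : Measure Plane) 2 *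
          ∑ i, eLpNorm (pderiv i φ) 1 volume := by
        gcongr
        rw [Fin.sum_univ_two, ← eLpNorm_norm (pderiv 0 φ), ← eLpNorm_norm (pderiv 1 φ)]
        refine (eLpNorm_mono_real (norm_fderiv_le φ)).trans (eLpNorm_add_le ?_ ?_ le_rfl)
        exacts [(continuous_pderiv hφ 0).norm.aestronglyMeasurable,
          (continuous_pderiv hφ 1).norm.aestronglyMeasurable]
    _ ≤ ladyzhenskayaConst * (eLpNorm v 2 volume * ∑ i, eLpNorm (pderiv i v) 2 volume) := by
        grw [Finset.sum_le_sum fun i _ => hpderiv i]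
        rw [← Finset.mul_sum, ladyzhenskayaConst]
        push_cast
        exact le_of_eq (by ring)

end Ladyzhenskaya

section LpConvergence

variable {α E : Type*} [MeasurableSpace α] {μ : Measure α} [NormedAddCommGroup E]
  {F : ℕ → α → E} {f : α → E}

lemma eLpNorm_two_sq (f : α → E) (μ : Measure α) : eLpNorm f 2 μ ^ 2 = ∫⁻ x, ‖f x‖ₑ ^ 2 ∂μ := by
  have h := eLpNorm_nnreal_pow_eq_lintegral (f := f) (μ := μ) (p := 2) two_ne_zero
  norm_num at h
  exact_mod_cast h

variable [InnerProductSpace ℝ E]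

lemma eLpNorm_add_sq_add_eLpNorm_sub_sq {f g : α → E} (hf : AEStronglyMeasurable f μ)
    (hg : AEStronglyMeasurable g μ) :
    eLpNorm (f + g) 2 μ ^ 2 + eLpNorm (f - g) 2 μ ^ 2 =
      2 * (eLpNorm f 2 μ ^ 2 + eLpNorm g 2 μ ^ 2) := by
  simp only [eLpNorm_two_sq]
  rw [← lintegral_add_left' ((hf.add hg).enorm.pow_const 2),
    ← lintegral_add_left' (hf.enorm.pow_const 2), ← lintegral_const_mul' _ _ (by simp)]
  refine lintegral_congr fun x => ?_
  simp only [Pi.add_apply, Pi.sub_apply, enorm_eq_nnnorm]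
  exact_mod_cast parallelogram_law_with_nnnorm ℝ (f x) (g x)

/- The parallelogram law turns the convergence `‖F n + f‖₂ → 2 ‖f‖₂`, which Fatou's lemma gives,
into `‖F n - f‖₂ → 0`. -/
lemma tendsto_eLpNorm_sub_of_tendsto_ae (hF : ∀ n, AEStronglyMeasurable (F n) μ)
    (hf : MemLp f 2 μ) (hle : ∀ n, eLpNorm (F n) 2 μ ≤ eLpNorm f 2 μ)
    (hlim : ∀ᵐ x ∂μ, Tendsto (fun n => F n x) atTop (𝓝 (f x))) :
    Tendsto (fun n => eLpNorm (F n - f) 2 μ) atTop (𝓝 0) := by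
  have hdouble : eLpNorm (f + f) 2 μ = 2 * eLpNorm f 2 μ := by
    rw [← two_smul ℝ f, eLpNorm_const_smul, ← ofReal_norm, Real.norm_ofNat, ENNReal.ofReal_ofNat]
  have hsum : Tendsto (fun n => eLpNorm (F n + f) 2 μ) atTop (𝓝 (2 * eLpNorm f 2 μ)) := by
    refine tendsto_of_le_liminf_of_limsup_le ?_ ?_
    · rw [← hdouble]
      exact Lp.eLpNorm_lim_le_liminf_eLpNorm (fun n => (hF n).add hf.1) _
        (hlim.mono fun x hx => hx.add_const (f x))
    · refine limsup_le_of_le (h := .of_forall fun n => ?_)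
      grw [eLpNorm_add_le (hF n) hf.1 one_le_two, hle n, two_mul]
  have hsq : Tendsto (fun n => eLpNorm (F n - f) 2 μ ^ 2) atTop (𝓝 0) := by
    have hfin : 2 * eLpNorm f 2 μ ≠ ⊤ := ENNReal.mul_ne_top ENNReal.ofNat_ne_top hf.2.ne
    have hsum_fin (n) : eLpNorm (F n + f) 2 μ ≠ ⊤ :=
      ((eLpNorm_add_le (hF n) hf.1 one_le_two).trans_lt
        (ENNReal.add_lt_top.2 ⟨(hle n).trans_lt hf.2, hf.2⟩)).ne
    have hdiff := ENNReal.Tendsto.sub (tendsto_const_nhds (x := (2 * eLpNorm f 2 μ) ^ 2))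
      (ENNReal.Tendsto.pow hsum (n := 2)) (.inl (ENNReal.pow_ne_top hfin))
    rw [tsub_self] at hdiff
    refine tendsto_of_tendsto_of_tendsto_of_le_of_le tendsto_const_nhds hdiff
      (fun n => zero_le) fun n => ?_
    refine ENNReal.le_sub_of_add_le_left (ENNReal.pow_ne_top (hsum_fin n)) ?_
    rw [eLpNorm_add_sq_add_eLpNorm_sub_sq (hF n) hf.1]
    grw [hle n]
    exact le_of_eq (by ring)
  simpa [← ENNReal.rpow_natCast_mul] using hsq.ennrpow_const (1 / 2)

lemma eLpNorm_norm_sq_sub_norm_sq_le {p r : ℝ≥0∞} [ENNReal.HolderTriple p p r] {f g : α → E}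
    (hf : AEStronglyMeasurable f μ) (hg : AEStronglyMeasurable g μ) :
    eLpNorm (fun x => ‖f x‖ ^ 2 - ‖g x‖ ^ 2) r μ ≤
      eLpNorm (f - g) p μ * eLpNorm (f + g) p μ := by
  have hfactor (x) : ‖f x‖ ^ 2 - ‖g x‖ ^ 2 = inner ℝ ((f - g) x) ((f + g) x) := by
    simp only [Pi.sub_apply, Pi.add_apply, inner_add_right, inner_sub_left,
      real_inner_self_eq_norm_sq, real_inner_comm (f x) (g x)]
    ring
  simp only [hfactor]
  simpa using eLpNorm_le_eLpNorm_mul_eLpNorm'_of_norm (hf.sub hg) (hf.add hg)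
    (fun a b => inner ℝ a b) 1 (.of_forall fun x => by
      simpa using norm_inner_le_norm (𝕜 := ℝ) ((f - g) x) ((f + g) x))

variable {p q : ℝ≥0∞} {w : α → ℝ}

omit [InnerProductSpace ℝ E] in
lemma integrable_mul_norm_sq (r : ℝ≥0∞) [ENNReal.HolderTriple p p r]
    [ENNReal.HolderTriple q r 1] (hw : MemLp w q μ) (hf : MemLp f p μ) :
    Integrable (fun x => w x * ‖f x‖ ^ 2) μ := by
  have hsq : MemLp (fun x => ‖f x‖ ^ 2) r μ := by simpa only [sq] using hf.norm.mul' hf.norm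
  exact memLp_one_iff_integrable.1 (hsq.mul' hw)

lemma tendsto_integral_mul_norm_sq (r : ℝ≥0∞) [ENNReal.HolderTriple p p r]
    [ENNReal.HolderTriple q r 1] (hw : MemLp w q μ) (hf : MemLp f p μ)
    (hF : ∀ n, MemLp (F n) p μ) (hlim : Tendsto (fun n => eLpNorm (F n - f) p μ) atTop (𝓝 0)) :
    Tendsto (fun n => ∫ x, w x * ‖F n x‖ ^ 2 ∂μ) atTop (𝓝 (∫ x, w x * ‖f x‖ ^ 2 ∂μ)) := by
  have hp : 1 ≤ p := (ENNReal.HolderTriple.le r q 1).trans (ENNReal.HolderTriple.le p p r)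
  have hinteg {g : α → E} (hg : MemLp g p μ) : Integrable (fun x => w x * ‖g x‖ ^ 2) μ :=
    integrable_mul_norm_sq r hw hg
  have hsum (n) : eLpNorm (F n + f) p μ ≤ eLpNorm (F n - f) p μ + 2 * eLpNorm f p μ :=
    calc eLpNorm (F n + f) p μ = eLpNorm (F n - f + (f + f)) p μ := by
          rw [← add_assoc, sub_add_cancel]
      _ ≤ eLpNorm (F n - f) p μ + 2 * eLpNorm f p μ := by
          grw [eLpNorm_add_le ((hF n).1.sub hf.1) (hf.1.add hf.1) hp,
            eLpNorm_add_le hf.1 hf.1 hp, two_mul]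
  have hbound (n) : eLpNorm (fun x => w x * ‖F n x‖ ^ 2 - w x * ‖f x‖ ^ 2) 1 μ ≤
      eLpNorm w q μ *
        (eLpNorm (F n - f) p μ * (eLpNorm (F n - f) p μ + 2 * eLpNorm f p μ)) := by
    simp only [← mul_sub]
    grw [← hsum n, ← eLpNorm_norm_sq_sub_norm_sq_le (r := r) (hF n).1 hf.1]
    exact eLpNorm_smul_le_mul_eLpNorm (p := q) (q := r) (r := 1) (φ := w)
      (((hF n).1.norm.pow 2).sub (hf.1.norm.pow 2)) hw.1
  refine tendsto_integral_of_L1' _ (hinteg hf).1 (.of_forall fun n => hinteg (hF n)) ?_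
  refine tendsto_of_tendsto_of_tendsto_of_le_of_le tendsto_const_nhds ?_ (fun n => zero_le) hbound
  have hprod := ENNReal.Tendsto.mul hlim (.inr (by finiteness [hf.2.ne]))
    (hlim.add_const (2 * eLpNorm f p μ)) (.inr ENNReal.zero_ne_top)
  simpa using ENNReal.Tendsto.const_mul hprod (.inr hw.2.ne)

end LpConvergence

section MollifyLp

variable {E : Type*} [NormedAddCommGroup E] [NormedSpace ℝ E] {f : Plane → E}

/-- The probability measure with density `mollifier n`, which exhibits a mollification as an
average of translates. -/
noncomputable def mollifierMeasure (n : ℕ) : Measure Plane :=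
  volume.withDensity fun t => ENNReal.ofReal (mollifier n t)

lemma measurable_ofReal_mollifier (n : ℕ) :
    Measurable fun t => ENNReal.ofReal (mollifier n t) :=
  (isTestFunction_mollifier n).1.continuous.measurable.ennreal_ofReal

instance isProbabilityMeasure_mollifierMeasure (n : ℕ) :
    IsProbabilityMeasure (mollifierMeasure n) where
  measure_univ := by
    rw [mollifierMeasure, withDensity_apply _ .univ, Measure.restrict_univ,
      ← ofReal_integral_eq_lintegral_ofReal (integrable_mollifier n)
        (.of_forall (mollifier_nonneg n)), integral_mollifier, ENNReal.ofReal_one]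

lemma mollify_mollifier_eq_integral (n : ℕ) (f : Plane → E) (x : Plane) :
    mollify (mollifier n) f x = ∫ t, f (x - t) ∂mollifierMeasure n := by
  rw [mollifierMeasure, integral_withDensity_eq_integral_toReal_smul
    (measurable_ofReal_mollifier n) (.of_forall fun _ => ENNReal.ofReal_lt_top), mollify_apply]
  simp only [ENNReal.toReal_ofReal (mollifier_nonneg n _)]

lemma eLpNorm_mollify_mollifier_le (n : ℕ) (hf : AEStronglyMeasurable f) {p : ℝ≥0}
    (hp : 1 ≤ p) : eLpNorm (mollify (mollifier n) f) p volume ≤ eLpNorm f p volume := by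
  have hp0 : p ≠ 0 := (one_pos.trans_le hp).ne'
  have hpair : AEStronglyMeasurable (fun z : Plane × Plane => f (z.1 - z.2))
      (volume.prod (mollifierMeasure n)) :=
    hf.comp_quasiMeasurePreserving (quasiMeasurePreserving_sub_of_right_invariant _ _)
  have hjensen : ∀ᵐ x, ‖mollify (mollifier n) f x‖ₑ ^ (p : ℝ) ≤
      ∫⁻ t, ‖f (x - t)‖ₑ ^ (p : ℝ) ∂mollifierMeasure n := by
    filter_upwards [hpair.prodMk_left] with x hx
    rw [← eLpNorm_nnreal_pow_eq_lintegral hp0, mollify_mollifier_eq_integral]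
    grw [enorm_integral_le_lintegral_enorm, ← eLpNorm_one_eq_lintegral_enorm,
      eLpNorm_le_eLpNorm_of_exponent_le (ENNReal.one_le_coe_iff.2 hp) hx]
  rw [← ENNReal.rpow_le_rpow_iff (z := p) (by positivity), eLpNorm_nnreal_pow_eq_lintegral hp0,
    eLpNorm_nnreal_pow_eq_lintegral hp0]
  calc ∫⁻ x, ‖mollify (mollifier n) f x‖ₑ ^ (p : ℝ)
      ≤ ∫⁻ x, ∫⁻ t, ‖f (x - t)‖ₑ ^ (p : ℝ) ∂mollifierMeasure n := lintegral_mono_ae hjensen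
    _ = ∫⁻ t, (∫⁻ x, ‖f (x - t)‖ₑ ^ (p : ℝ)) ∂mollifierMeasure n :=
        lintegral_lintegral_swap (hpair.enorm.pow_const _)
    _ = ∫⁻ x, ‖f x‖ₑ ^ (p : ℝ) := by
        simp_rw [fun t => lintegral_sub_right_eq_self (μ := volume) (‖f ·‖ₑ ^ (p : ℝ)) t,
          lintegral_const, measure_univ, mul_one]

end MollifyLp

section Cutoff

/-- Smooth cutoff functions at distance of order `n + 1` from the origin. -/
noncomputable def cutoff (n : ℕ) (x : Plane) : ℝ := bump 0 (((n : ℝ) + 1)⁻¹ • x)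

lemma contDiff_cutoff (n : ℕ) : ContDiff ℝ ∞ (cutoff n) :=
  (bump 0).contDiff.comp (contDiff_const_smul _)

lemma hasCompactSupport_cutoff (n : ℕ) : HasCompactSupport (cutoff n) :=
  (bump 0).hasCompactSupport.comp_smul (by positivity)

lemma abs_cutoff_le_one (n : ℕ) (x : Plane) : |cutoff n x| ≤ 1 := by
  rw [cutoff, abs_of_nonneg (bump 0).nonneg]
  exact (bump 0).le_one

lemma tendsto_cutoff (x : Plane) : Tendsto (fun n => cutoff n x) atTop (𝓝 1) := by
  have hscale : Tendsto (fun n : ℕ => ((n : ℝ) + 1)⁻¹ • x) atTop (𝓝 0) := by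
    simpa using (tendsto_one_div_add_atTop_nhds_zero_nat (𝕜 := ℝ)).smul_const x
  rw [← (bump 0).one_of_mem_closedBall (Metric.mem_closedBall_self (bump 0).rIn_pos.le)]
  exact ((bump 0).continuous.tendsto 0).comp hscale

lemma pderiv_cutoff (n : ℕ) (i : Fin 2) (x : Plane) :
    pderiv i (cutoff n) x = ((n : ℝ) + 1)⁻¹ * pderiv i (bump 0) (((n : ℝ) + 1)⁻¹ • x) := by
  rw [pderiv]
  exact congr($(fderiv_comp_smul (f := bump 0) ((n : ℝ) + 1)⁻¹) (EuclideanSpace.single i 1))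

lemma exists_abs_pderiv_cutoff_le (i : Fin 2) :
    ∃ C : ℝ, ∀ n x, |pderiv i (cutoff n) x| ≤ C * (1 / ((n : ℝ) + 1)) := by
  obtain ⟨C, hC⟩ := (hasCompactSupport_pderiv (bump 0).hasCompactSupport i
    ).exists_bound_of_continuous (continuous_pderiv (bump 0).contDiff i)
  refine ⟨C, fun n x => ?_⟩
  rw [pderiv_cutoff, abs_mul, abs_of_nonneg (by positivity), mul_comm, one_div]
  gcongr
  exact hC _

end Cutoff

section Approximation

section InnerProductSpace

variable {E : Type*} [NormedAddCommGroup E] [InnerProductSpace ℝ E] {f : Plane → E}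

/-- The regularization of `f` by cutoff and mollification. -/
noncomputable def regularize (n : ℕ) (f : Plane → E) (x : Plane) : E :=
  cutoff n x • mollify (mollifier n) f x

lemma contDiff_regularize (n : ℕ) (hf : LocallyIntegrable f) : ContDiff ℝ ∞ (regularize n f) :=
  (contDiff_cutoff n).smul (contDiff_mollify_mollifier n hf)

lemma hasCompactSupport_regularize (n : ℕ) (f : Plane → E) :
    HasCompactSupport (regularize n f) :=
  (hasCompactSupport_cutoff n).smul_right

lemma tendsto_regularize [CompleteSpace E] (hf : LocallyIntegrable f) :
    ∀ᵐ x, Tendsto (fun n => regularize n f x) atTop (𝓝 (f x)) := by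
  filter_upwards [tendsto_mollify_mollifier hf] with x hx
  simpa only [one_smul, regularize] using (tendsto_cutoff x).smul hx

lemma tendsto_eLpNorm_regularize_sub [CompleteSpace E] (hf : MemLp f 2) :
    Tendsto (fun n => eLpNorm (regularize n f - f) 2 volume) atTop (𝓝 0) := by
  have hloc : LocallyIntegrable f := hf.locallyIntegrable one_le_two
  refine tendsto_eLpNorm_sub_of_tendsto_ae
    (fun n => (contDiff_regularize n hloc).continuous.aestronglyMeasurable) hf (fun n => ?_)
    (tendsto_regularize hloc)
  refine (eLpNorm_mono fun x => ?_).trans (eLpNorm_mollify_mollifier_le n hf.1 one_le_two)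
  rw [regularize, norm_smul]
  exact mul_le_of_le_one_left (norm_nonneg _) (abs_cutoff_le_one n x)

lemma tendsto_eLpNorm_pderiv_cutoff_smul (hf : MemLp f 2) (i : Fin 2) :
    Tendsto (fun n => eLpNorm (pderiv i (cutoff n) • mollify (mollifier n) f) 2 volume)
      atTop (𝓝 0) := by
  obtain ⟨C, hC⟩ := exists_abs_pderiv_cutoff_le i
  have hbound (n : ℕ) : eLpNorm (pderiv i (cutoff n) • mollify (mollifier n) f) 2 volume ≤
      ENNReal.ofReal (C * (1 / ((n : ℝ) + 1))) * eLpNorm f 2 volume := by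
    refine le_trans (eLpNorm_le_mul_eLpNorm_of_ae_le_mul (.of_forall fun x => ?_) 2)
      (mul_le_mul_right (eLpNorm_mollify_mollifier_le n hf.1 one_le_two) _)
    exact (norm_smul_le _ _).trans (mul_le_mul_of_nonneg_right (hC n x) (norm_nonneg _))
  refine tendsto_of_tendsto_of_tendsto_of_le_of_le tendsto_const_nhds ?_ (fun n => zero_le)
    hbound
  have hcoeff := ENNReal.tendsto_ofReal
    ((tendsto_one_div_add_atTop_nhds_zero_nat (𝕜 := ℝ)).const_mul C)
  simpa using ENNReal.Tendsto.mul_const hcoeff (.inr hf.2.ne)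

end InnerProductSpace

variable {u : Plane → ℂ} {Du : Fin 2 → Plane → ℂ}

lemma HasH1Gradient.pderiv_mollify_mollifier (hu : HasH1Gradient u Du) (n : ℕ) (i : Fin 2) :
    pderiv i (mollify (mollifier n) u) = mollify (mollifier n) (Du i) := by
  have htest := isTestFunction_mollifier n
  have htest1 : ContDiff ℝ 1 (mollifier n) := htest.1.of_le (by exact_mod_cast le_top)
  rw [pderiv_mollify htest1 htest.2 (hu.memLp.locallyIntegrable one_le_two)]
  ext x
  have hweak := hu.weak_deriv i _ (isTestFunction_comp_const_sub htest x)
  simp only [partialDeriv_eq_pderiv, pderiv_comp_const_sub (htest1.differentiable one_ne_zero),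
    Complex.ofReal_neg, neg_mul, integral_neg, neg_inj, ← Complex.real_smul] at hweak
  rw [mollify_apply_swap, mollify_apply_swap, hweak]

lemma HasH1Gradient.pderiv_regularize (hu : HasH1Gradient u Du) (n : ℕ) (i : Fin 2) :
    pderiv i (regularize n u) =
      regularize n (Du i) + pderiv i (cutoff n) • mollify (mollifier n) u := by
  ext x
  have hcutoff := (contDiff_cutoff n).differentiable (by simp) x
  have hmollify := (contDiff_mollify_mollifier n (hu.memLp.locallyIntegrable one_le_two)
    ).differentiable (by simp) x
  refine (pderiv_eq_of_hasFDerivAt (hcutoff.hasFDerivAt.smul hmollify.hasFDerivAt) i).trans ?_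
  simp [regularize, ← hu.pderiv_mollify_mollifier, pderiv]

/-- Smooth compactly supported functions `w n` that converge to `u` in `H¹(ℝ²)` and almost
everywhere. -/
structure IsTestApproximation (w : ℕ → Plane → ℂ) (u : Plane → ℂ) (Du : Fin 2 → Plane → ℂ) :
    Prop where
  contDiff n : ContDiff ℝ ∞ (w n)
  hasCompactSupport n : HasCompactSupport (w n)
  tendsto_ae : ∀ᵐ x, Tendsto (fun n => w n x) atTop (𝓝 (u x))
  tendsto_eLpNorm_sub : Tendsto (fun n => eLpNorm (w n - u) 2 volume) atTop (𝓝 0)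
  tendsto_eLpNorm_pderiv_sub i :
    Tendsto (fun n => eLpNorm (pderiv i (w n) - Du i) 2 volume) atTop (𝓝 0)

lemma HasH1Gradient.isTestApproximation_regularize (hu : HasH1Gradient u Du) :
    IsTestApproximation (regularize · u) u Du where
  contDiff n := contDiff_regularize n (hu.memLp.locallyIntegrable one_le_two)
  hasCompactSupport n := hasCompactSupport_regularize n u
  tendsto_ae := tendsto_regularize (hu.memLp.locallyIntegrable one_le_two)
  tendsto_eLpNorm_sub := tendsto_eLpNorm_regularize_sub hu.memLp
  tendsto_eLpNorm_pderiv_sub i := by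
    have hloc : LocallyIntegrable u := hu.memLp.locallyIntegrable one_le_two
    have hmain (n) : AEStronglyMeasurable (regularize n (Du i) - Du i) :=
      (contDiff_regularize n ((hu.memLp_grad i).locallyIntegrable one_le_two)
        ).continuous.aestronglyMeasurable.sub (hu.memLp_grad i).1
    have hcommutator (n) :
        AEStronglyMeasurable (pderiv i (cutoff n) • mollify (mollifier n) u) :=
      (continuous_pderiv ((contDiff_cutoff n).of_le (by exact_mod_cast le_top)) i).smul
        (contDiff_mollify_mollifier n hloc).continuous |>.aestronglyMeasurable
    have hbound (n) : eLpNorm (pderiv i (regularize n u) - Du i) 2 volume ≤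
        eLpNorm (regularize n (Du i) - Du i) 2 volume +
          eLpNorm (pderiv i (cutoff n) • mollify (mollifier n) u) 2 volume := by
      rw [hu.pderiv_regularize, add_sub_right_comm]
      exact eLpNorm_add_le (hmain n) (hcommutator n) one_le_two
    refine tendsto_of_tendsto_of_tendsto_of_le_of_le tendsto_const_nhds ?_ (fun n => zero_le)
      hbound
    simpa only [add_zero] using (tendsto_eLpNorm_regularize_sub (hu.memLp_grad i)).add
      (tendsto_eLpNorm_pderiv_cutoff_smul hu.memLp i)

end Approximation

section FormLimits

variable {u : Plane → ℂ} {Du : Fin 2 → Plane → ℂ} {w : ℕ → Plane → ℂ} {A : Plane → Plane}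
  {B : Plane → ℝ} {ρ : ℝ}

/-- The `H¹` distance of a smooth function `v` to a function `u` with weak gradient `Du`. -/
noncomputable def h1Dist (u : Plane → ℂ) (Du : Fin 2 → Plane → ℂ) (v : Plane → ℂ) : ℝ≥0∞ :=
  eLpNorm (v - u) 2 volume + ∑ i, eLpNorm (pderiv i v - Du i) 2 volume

lemma eLpNorm_four_le {v : Plane → ℂ} (hv : ContDiff ℝ 1 v) (hvc : HasCompactSupport v) :
    eLpNorm v 4 volume ≤ NNReal.sqrt ladyzhenskayaConst *
      (eLpNorm v 2 volume + ∑ i, eLpNorm (pderiv i v) 2 volume) := by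
  rw [← ENNReal.pow_le_pow_left_iff two_ne_zero, mul_pow, ← ENNReal.coe_pow, NNReal.sq_sqrt,
    sq (_ + _)]
  grw [eLpNorm_four_sq_le hv hvc]
  gcongr
  exacts [le_self_add, le_add_self]

namespace IsTestApproximation

lemma contDiff_one (hw : IsTestApproximation w u Du) (n : ℕ) : ContDiff ℝ 1 (w n) :=
  (hw.contDiff n).of_le (by exact_mod_cast le_top)

lemma memLp (hw : IsTestApproximation w u Du) (n : ℕ) (p : ℝ≥0∞) : MemLp (w n) p :=
  (hw.contDiff n).continuous.memLp_of_hasCompactSupport (hw.hasCompactSupport n)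

lemma tendsto_h1Dist (hw : IsTestApproximation w u Du) :
    Tendsto (fun n => h1Dist u Du (w n)) atTop (𝓝 0) := by
  simpa [h1Dist] using hw.tendsto_eLpNorm_sub.add
    (tendsto_finsetSum Finset.univ fun i _ => hw.tendsto_eLpNorm_pderiv_sub i)

lemma h1Dist_ne_top (hw : IsTestApproximation w u Du) (hu : HasH1Gradient u Du) (n : ℕ) :
    h1Dist u Du (w n) ≠ ⊤ :=
  ENNReal.add_ne_top.2 ⟨((hw.memLp n 2).sub hu.memLp).2.ne, ENNReal.sum_ne_top.2 fun i _ =>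
    ((memLp_pderiv (hw.contDiff_one n) (hw.hasCompactSupport n) i 2).sub (hu.memLp_grad i)).2.ne⟩

lemma eLpNorm_four_sub_le_add (hw : IsTestApproximation w u Du) (hu : HasH1Gradient u Du)
    (n m : ℕ) : eLpNorm (w n - w m) 4 volume ≤
      NNReal.sqrt ladyzhenskayaConst * (h1Dist u Du (w n) + h1Dist u Du (w m)) := by
  have hpderiv (i) : pderiv i (w n - w m) = pderiv i (w n) - pderiv i (w m) := by
    ext x
    have hdiff (k) := ((hw.contDiff_one k).differentiable one_ne_zero x).hasFDerivAt
    exact pderiv_eq_of_hasFDerivAt ((hdiff n).sub (hdiff m)) i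
  have htriangle {f g k : Plane → ℂ} (hf : MemLp f 2) (hg : MemLp g 2) (hk : MemLp k 2) :
      eLpNorm (f - g) 2 volume ≤ eLpNorm (f - k) 2 volume + eLpNorm (g - k) 2 volume := by
    rw [← sub_sub_sub_cancel_right f g k]
    exact eLpNorm_sub_le (hf.sub hk).1 (hg.sub hk).1 one_le_two
  have hgrad (k) (i) := memLp_pderiv (hw.contDiff_one k) (hw.hasCompactSupport k) i 2
  have hsmooth : ContDiff ℝ 1 (w n - w m) := (hw.contDiff_one n).sub (hw.contDiff_one m)
  grw [eLpNorm_four_le hsmooth ((hw.hasCompactSupport n).sub (hw.hasCompactSupport m)),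
    htriangle (hw.memLp n 2) (hw.memLp m 2) hu.memLp, h1Dist, h1Dist, add_add_add_comm,
    ← Finset.sum_add_distrib]
  gcongr with i
  rw [hpderiv]
  exact htriangle (hgrad n i) (hgrad m i) (hu.memLp_grad i)

lemma eLpNorm_four_sub_le (hw : IsTestApproximation w u Du) (hu : HasH1Gradient u Du) (n : ℕ) :
    eLpNorm (w n - u) 4 volume ≤ NNReal.sqrt ladyzhenskayaConst * h1Dist u Du (w n) := by
  have hae : ∀ᵐ x, Tendsto (fun m => (w n - w m) x) atTop (𝓝 ((w n - u) x)) := by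
    filter_upwards [hw.tendsto_ae] with x hx using hx.const_sub _
  have hbound : Tendsto (fun m => NNReal.sqrt ladyzhenskayaConst *
      (h1Dist u Du (w n) + h1Dist u Du (w m))) atTop
      (𝓝 (NNReal.sqrt ladyzhenskayaConst * h1Dist u Du (w n))) := by
    simpa using ENNReal.Tendsto.const_mul (hw.tendsto_h1Dist.const_add _)
      (.inr (ENNReal.coe_ne_top (r := NNReal.sqrt ladyzhenskayaConst)))
  calc eLpNorm (w n - u) 4 volume
      ≤ atTop.liminf fun m => eLpNorm (w n - w m) 4 volume :=
        Lp.eLpNorm_lim_le_liminf_eLpNorm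
          (fun m => ((hw.memLp n 4).sub (hw.memLp m 4)).1) _ hae
    _ ≤ atTop.liminf fun m => NNReal.sqrt ladyzhenskayaConst *
          (h1Dist u Du (w n) + h1Dist u Du (w m)) :=
        liminf_le_liminf (.of_forall (hw.eLpNorm_four_sub_le_add hu n))
    _ = _ := hbound.liminf_eq

lemma tendsto_eLpNorm_four_sub (hw : IsTestApproximation w u Du) (hu : HasH1Gradient u Du) :
    Tendsto (fun n => eLpNorm (w n - u) 4 volume) atTop (𝓝 0) := by
  refine tendsto_of_tendsto_of_tendsto_of_le_of_le tendsto_const_nhds ?_ (fun n => zero_le)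
    (hw.eLpNorm_four_sub_le hu)
  simpa using ENNReal.Tendsto.const_mul hw.tendsto_h1Dist
    (.inr (ENNReal.coe_ne_top (r := NNReal.sqrt ladyzhenskayaConst)))

lemma tendsto_eLpNorm_magnetic_sub (hw : IsTestApproximation w u Du) (hu : HasH1Gradient u Du)
    (hA : MemLp A ∞) (j : Fin 2) :
    Tendsto (fun n => eLpNorm ((fun x => I * pderiv j (w n) x + A x j * w n x) -
      fun x => I * Du j x + A x j * u x) 2 volume) atTop (𝓝 0) := by
  have hAj : MemLp (fun x => (A x j : ℂ)) ∞ :=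
    (Complex.ofRealCLM ∘L (EuclideanSpace.proj j : Plane →L[ℝ] ℝ)).comp_memLp' hA
  have hgrad (n) : MemLp (pderiv j (w n) - Du j) 2 :=
    (memLp_pderiv (hw.contDiff_one n) (hw.hasCompactSupport n) j 2).sub (hu.memLp_grad j)
  have hfun (n) : MemLp (w n - u) 2 := (hw.memLp n 2).sub hu.memLp
  have hbound (n) : eLpNorm ((fun x => I * pderiv j (w n) x + A x j * w n x) -
      fun x => I * Du j x + A x j * u x) 2 volume ≤ eLpNorm (pderiv j (w n) - Du j) 2 volume +
        eLpNorm (fun x => (A x j : ℂ)) ∞ volume * eLpNorm (w n - u) 2 volume := by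
    have hsplit : ((fun x => I * pderiv j (w n) x + A x j * w n x) -
        fun x => I * Du j x + A x j * u x) =
        I • (pderiv j (w n) - Du j) + (fun x => (A x j : ℂ)) • (w n - u) := by
      ext x
      simp only [Pi.sub_apply, Pi.add_apply, Pi.smul_apply, Pi.mul_apply, smul_eq_mul]
      ring
    rw [hsplit]
    grw [eLpNorm_add_le ((hgrad n).const_smul I).1 (hAj.1.smul (hfun n).1) one_le_two,
      eLpNorm_smul_le_eLpNorm_top_mul_eLpNorm 2 (hfun n).1, eLpNorm_const_smul, ← ofReal_norm,
      Complex.norm_I, ENNReal.ofReal_one, one_mul]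
  refine tendsto_of_tendsto_of_tendsto_of_le_of_le tendsto_const_nhds ?_ (fun n => zero_le) hbound
  simpa using (hw.tendsto_eLpNorm_pderiv_sub j).add
    (ENNReal.Tendsto.const_mul hw.tendsto_eLpNorm_sub (.inr hAj.2.ne))

end IsTestApproximation

lemma HasH1Gradient.memLp_four (hu : HasH1Gradient u Du) : MemLp u 4 := by
  have hw := hu.isTestApproximation_regularize
  have hdiff : MemLp (regularize 0 u - u) 4 :=
    ⟨((hw.memLp 0 2).sub hu.memLp).1, (hw.eLpNorm_four_sub_le hu 0).trans_lt
      (ENNReal.mul_lt_top ENNReal.coe_lt_top (hw.h1Dist_ne_top hu 0).lt_top)⟩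
  simpa using (hw.memLp 0 4).sub hdiff

instance holderTriple_four_four_two : ENNReal.HolderTriple 4 4 2 where
  inv_add_inv_eq_inv := by
    rw [← two_mul, show (4 : ℝ≥0∞) = 2 * 2 by norm_num,
      ENNReal.mul_inv (.inl two_ne_zero) (.inl ENNReal.ofNat_ne_top), ← mul_assoc,
      ENNReal.mul_inv_cancel two_ne_zero ENNReal.ofNat_ne_top, one_mul]

lemma IsIntegrableField.memLp_two (hB : IsIntegrableField B) : MemLp B 2 :=
  (memLp_two_iff_integrable_sq hB.integrable.aestronglyMeasurable).2 hB.integrable_sq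

lemma memLp_hardy_weight (hρ : 0 < ρ) : MemLp (fun x : Plane => (ρ ^ 2 + ‖x‖ ^ 2)⁻¹) ∞ := by
  refine memLp_top_of_bound (Continuous.aestronglyMeasurable ?_) (ρ ^ 2)⁻¹
    (.of_forall fun x => ?_)
  · exact Continuous.inv₀ (by fun_prop) fun x => by positivity
  · rw [Real.norm_of_nonneg (by positivity)]
    gcongr
    exact le_add_of_nonneg_right (by positivity)

lemma integrable_hardy_term {f : Plane → ℂ} (hρ : 0 < ρ) (hf : MemLp f 2) :
    Integrable fun x => ‖f x‖ ^ 2 / (ρ ^ 2 + ‖x‖ ^ 2) := by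
  simpa only [div_eq_inv_mul] using integrable_mul_norm_sq 1 (memLp_hardy_weight hρ) hf

section Density

variable {v : Plane → ℂ} {Dv : Fin 2 → Plane → ℂ}

lemma integrable_magnetic_sq (hA : MemLp A ∞) (hv : MemLp v 2) (hDv : ∀ i, MemLp (Dv i) 2)
    (j : Fin 2) : Integrable fun x => ‖I * Dv j x + A x j * v x‖ ^ 2 :=
  (memLp_two_iff_integrable_sq_norm (memLp_magnetic hA hv (hDv j) j).1).1
    (memLp_magnetic hA hv (hDv j) j)

lemma integrable_pauliPlusDensity (hB : IsIntegrableField B) (hA : MemLp A ∞) (hv : MemLp v 2)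
    (hDv : ∀ i, MemLp (Dv i) 2) (hv4 : MemLp v 4) :
    Integrable (pauliPlusDensity A B v Dv) :=
  (integrable_finsetSum _ fun j _ => integrable_magnetic_sq hA hv hDv j).add
    (integrable_mul_norm_sq 2 hB.memLp_two hv4)

lemma pauliPlusForm_eq_sum_integral_add (hB : IsIntegrableField B) (hA : MemLp A ∞)
    (hv : MemLp v 2) (hDv : ∀ i, MemLp (Dv i) 2) (hv4 : MemLp v 4) :
    pauliPlusForm A B v Dv =
      ∑ j, (∫ x, ‖I * Dv j x + A x j * v x‖ ^ 2) + ∫ x, B x * ‖v x‖ ^ 2 := by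
  have hmagnetic (j) := integrable_magnetic_sq hA hv hDv j
  rw [← integral_finsetSum _ fun j _ => hmagnetic j, ← integral_add
    (integrable_finsetSum _ fun j _ => hmagnetic j)
    (integrable_mul_norm_sq 2 hB.memLp_two hv4)]
  rfl

end Density

lemma IsTestApproximation.tendsto_pauliPlusForm (hw : IsTestApproximation w u Du)
    (hu : HasH1Gradient u Du) (hB : IsIntegrableField B) (hA : MemLp A ∞) :
    Tendsto (fun n => pauliPlusForm A B (w n) (pderiv · (w n))) atTop
      (𝓝 (pauliPlusForm A B u Du)) := by
  have hgrad (n) (i) := memLp_pderiv (hw.contDiff_one n) (hw.hasCompactSupport n) i 2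
  rw [pauliPlusForm_eq_sum_integral_add hB hA hu.memLp hu.memLp_grad hu.memLp_four]
  simp only [pauliPlusForm_eq_sum_integral_add hB hA (hw.memLp _ 2) (hgrad _) (hw.memLp _ 4)]
  refine (tendsto_finsetSum _ fun j _ => ?_).add (tendsto_integral_mul_norm_sq 2 hB.memLp_two
    hu.memLp_four (fun n => hw.memLp n 4) (hw.tendsto_eLpNorm_four_sub hu))
  simpa only [one_mul] using tendsto_integral_mul_norm_sq 1 (memLp_top_const (1 : ℝ))
    (memLp_magnetic hA hu.memLp (hu.memLp_grad j) j)
    (fun n => memLp_magnetic hA (hw.memLp n 2) (hgrad n j) j)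
    (hw.tendsto_eLpNorm_magnetic_sub hu hA j)

lemma hardy_pauliPlusForm (hB : IsIntegrableField B) (hflux : 0 ≤ flux B) (hA : MemLp A ∞)
    (hcurl : HasDistribCurl A B) (hρ : 0 < ρ) (hu : HasH1Gradient u Du) :
    distInt (flux B) ^ 2 * betaPlus B ρ * (∫ x, ‖u x‖ ^ 2 / (ρ ^ 2 + ‖x‖ ^ 2)) ≤
      pauliPlusForm A B u Du := by
  have hw := hu.isTestApproximation_regularize
  have hhardy : Tendsto (fun n => ∫ x, ‖regularize n u x‖ ^ 2 / (ρ ^ 2 + ‖x‖ ^ 2)) atTop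
      (𝓝 (∫ x, ‖u x‖ ^ 2 / (ρ ^ 2 + ‖x‖ ^ 2))) := by
    simpa only [div_eq_inv_mul] using tendsto_integral_mul_norm_sq 1 (memLp_hardy_weight hρ)
      hu.memLp (fun n => hw.memLp n 2) hw.tendsto_eLpNorm_sub
  refine le_of_tendsto_of_tendsto' (hhardy.const_mul _) (hw.tendsto_pauliPlusForm hu hB hA)
    fun n => ?_
  rw [pauliPlusForm_eq_integral_magneticWirtinger hB.integrable.locallyIntegrable hA hcurl
    (hw.contDiff n) (hw.hasCompactSupport n)]
  exact hardy_magneticWirtinger hB hflux hA hcurl hρ ((hw.contDiff n).of_le two_le_infty)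
    (hw.hasCompactSupport n)

end FormLimits

end PauliHardy

open PauliHardy in
theorem theorem2p2_general {B : Plane → ℝ} (hB : IsIntegrableField B) (hflux : 0 ≤ flux B)
    {A : Plane → Plane} (hA : MemLp A ∞) (hcurl : HasDistribCurl A B) :
    (∀ x, Integrable fun y => B y * Real.log ‖x - y‖) ∧
    ∀ ρ : ℝ, 0 < ρ → (0 < kPlus B ρ ∧ BddAbove (Set.range (ratioPlus B ρ))) ∧
      ∀ (u : Plane → ℂ) (Du : Fin 2 → Plane → ℂ), HasH1Gradient u Du →
        Integrable (pauliPlusDensity A B u Du) ∧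
        Integrable (fun x => ‖u x‖ ^ 2 / (ρ ^ 2 + ‖x‖ ^ 2)) ∧
        distInt (flux B) ^ 2 * betaPlus B ρ * ∫ x, ‖u x‖ ^ 2 / (ρ ^ 2 + ‖x‖ ^ 2) ≤
          pauliPlusForm A B u Du :=
  ⟨hB.integrable_mul_log_norm_sub, fun _ hρ =>
    ⟨⟨hB.kPlus_pos hρ, hB.bddAbove_range_ratioPlus hρ⟩, fun _ _ hu =>
      ⟨integrable_pauliPlusDensity hB hA hu.memLp hu.memLp_grad hu.memLp_four,
        integrable_hardy_term hρ hu.memLp, hardy_pauliPlusForm hB hflux hA hcurl hρ hu⟩⟩⟩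

theorem theorem2p2 (B : PauliHardy.Plane → ℝ) (hB : PauliHardy.FieldAssumption B)
    (hflux_pos : 0 < PauliHardy.flux B) (hflux_int : ∀ m : ℤ, PauliHardy.flux B ≠ (m : ℝ))
    (A : PauliHardy.Plane → PauliHardy.Plane) (hA : MemLp A ∞ volume)
    (hcurl : PauliHardy.HasDistribCurl A B) :
    -- the potential, the constants and the integrals below are well defined,
    (∀ x : PauliHardy.Plane, Integrable (fun y => B y * Real.log ‖x - y‖) volume) ∧
    ∀ ρ : ℝ, 0 < ρ →
      (0 < PauliHardy.kPlus B ρ ∧ BddAbove (Set.range (PauliHardy.ratioPlus B ρ))) ∧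
      ∀ (u : PauliHardy.Plane → ℂ) (Du : Fin 2 → PauliHardy.Plane → ℂ),
        PauliHardy.HasH1Gradient u Du →
        Integrable (PauliHardy.pauliPlusDensity A B u Du) volume ∧
        Integrable (fun x => ‖u x‖ ^ 2 / (ρ ^ 2 + ‖x‖ ^ 2)) volume ∧
        -- and the Hardy inequality holds.
        PauliHardy.distInt (PauliHardy.flux B) ^ 2 * PauliHardy.betaPlus B ρ *
            ∫ x, ‖u x‖ ^ 2 / (ρ ^ 2 + ‖x‖ ^ 2)
          ≤ PauliHardy.pauliPlusForm A B u Du :=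
  theorem2p2_general hB.isIntegrableField hflux_pos.le hA hcurl
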